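/- For a finite simple undirected graph $G$ and an edge $e=uv$ of $G$, the contraction $G/e$ is the simple graph obtained by deleting $u$ and $v$ and adding one new vertex that is adjacent to every vertex of $(N_G(u)\cup N_G(v))\setminus\{u,v\}$. Path Contraction is the following decision problem: given a connected graph $G$ and a natural number $k$, decide whether a path (a path graph $P_\ell$ on some number $\ell\ge 1$ of vertices) can be obtained from $G$ by a sequence of at most $k$ edge contractions. Path Contraction can be solved in $\mathcal{O}^*(2^k)$ time. That is, there are one deterministic algorithm (a random access machine program, with time measured by the logarithmic cost criterion) and a constant $c$ such that, for every connected graph $G$ with $n$ vertices, given by its adjacency matrix, and every natural number $k$, the algorithm halts on input $(G,k)$ after time at most $c\cdot 2^k\cdot n^{c}$, with output $1$ if a path can be obtained from $G$ by at most $k$ edge contractions, and with output $0$ otherwise. -/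

import Mathlib

namespace PathContr

universe u

/-! ### Edge contractions and the problem -/

/-- The graph obtained from `G` by contracting the pair `u`, `v` (used when `u v` is an edge).
Its vertices are those of `G` other than `u` and `v`, written `some x`, and one new vertex, written
`none`, which is adjacent to the remaining neighbours of `u` and of `v`. -/
def contractEdge {V : Type u} (G : SimpleGraph V) (u v : V) :
    SimpleGraph {x : Option V // x ≠ some u ∧ x ≠ some v} where
  Adj a b :=
    match a.1, b.1 with
    | some x, some y => G.Adj x y
    | none, some y => G.Adj u y ∨ G.Adj v y
    | some x, none => G.Adj u x ∨ G.Adj v x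
    | none, none => False
  symm := ⟨by
    rintro ⟨_ | x, hx⟩ ⟨_ | y, hy⟩ h
    · exact h
    · exact h
    · exact h
    · exact SimpleGraph.Adj.symm h⟩
  loopless := ⟨by
    rintro ⟨_ | x, hx⟩ h
    · exact h
    · exact G.loopless.irrefl x h⟩

/-- `G` is a path `P_ℓ` on some number `ℓ ≥ 1` of vertices (one vertex is allowed). -/
def IsPathGraph {V : Type u} (G : SimpleGraph V) : Prop :=
  ∃ ℓ : ℕ, 1 ≤ ℓ ∧ Nonempty (G ≃g SimpleGraph.pathGraph ℓ)

/-- A path can be obtained from `G` by a sequence of at most `k` edge contractions. -/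
def ContractibleToPath : ℕ → ∀ {V : Type u}, SimpleGraph V → Prop
  | 0, _, G => IsPathGraph G
  | k + 1, _, G =>
      IsPathGraph G ∨ ∃ u v, G.Adj u v ∧ ContractibleToPath k (contractEdge G u v)

/-! ### Random access machine with logarithmic cost

Programs are structured programs (assignments, branching, loops) over a store of natural numbers.
The store has registers and arrays; a register or an array is named by a number that is fixed in
the program, so one program uses finitely many of them, while the index into an array is computed
at run time (indirect addressing). Every operation is charged one step plus the bit lengths of all
the numbers and indices that it handles, so large numbers cannot be used to save time. -/

/-- The contents of the registers and of the arrays. -/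
structure Store where
  reg : ℕ → ℕ
  arr : ℕ → ℕ → ℕ

/-- The arithmetic operations; subtraction is truncated at zero, division rounds down. -/
inductive Op
  | add
  | sub
  | mul
  | div

/-- The value of an operation. -/
def Op.apply : Op → ℕ → ℕ → ℕ
  | .add, a, b => a + b
  | .sub, a, b => a - b
  | .mul, a, b => a * b
  | .div, a, b => a / b

/-- Expressions: constants, the content of a register, an array entry, arithmetic. -/
inductive AExp
  | lit (c : ℕ)
  | reg (x : ℕ)
  | load (a : ℕ) (i : AExp)
  | op (o : Op) (e₁ e₂ : AExp)

/-- The value of an expression. -/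
def AExp.val (s : Store) : AExp → ℕ
  | .lit c => c
  | .reg x => s.reg x
  | .load a i => s.arr a (i.val s)
  | .op o e₁ e₂ => o.apply (e₁.val s) (e₂.val s)

/-- The time needed to evaluate an expression; `Nat.size` is the length in binary. -/
def AExp.cost (s : Store) : AExp → ℕ
  | .lit c => 1 + c.size
  | .reg x => 1 + (s.reg x).size
  | .load a i => i.cost s + 1 + (i.val s).size + (s.arr a (i.val s)).size
  | .op o e₁ e₂ =>
      e₁.cost s + e₂.cost s + 1 + (e₁.val s).size + (e₂.val s).size
        + (o.apply (e₁.val s) (e₂.val s)).size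

/-- Programs. A guard counts as true if its value is not zero. -/
inductive Cmd
  | skip
  | assign (x : ℕ) (e : AExp)
  | store (a : ℕ) (i e : AExp)
  | seq (p q : Cmd)
  | branch (e : AExp) (p q : Cmd)
  | loop (e : AExp) (p : Cmd)

/-- The store after writing `v` into register `x`. -/
def Store.setReg (s : Store) (x v : ℕ) : Store :=
  { s with reg := Function.update s.reg x v }

/-- The store after writing `v` at index `i` of array `a`. -/
def Store.setArr (s : Store) (a i v : ℕ) : Store :=
  { s with arr := Function.update s.arr a (Function.update (s.arr a) i v) }

/-- `Exec p s s' t`: started in `s`, the program `p` halts in `s'` after time exactly `t`. -/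
inductive Exec : Cmd → Store → Store → ℕ → Prop
  | skip (s : Store) : Exec .skip s s 1
  | assign (s : Store) (x : ℕ) (e : AExp) :
      Exec (.assign x e) s (s.setReg x (e.val s)) (e.cost s + 1 + (e.val s).size)
  | store (s : Store) (a : ℕ) (i e : AExp) :
      Exec (.store a i e) s (s.setArr a (i.val s) (e.val s))
        (i.cost s + e.cost s + 1 + (i.val s).size + (e.val s).size)
  | seq {p q : Cmd} {s s₁ s₂ : Store} {t₁ t₂ : ℕ} :
      Exec p s s₁ t₁ → Exec q s₁ s₂ t₂ → Exec (.seq p q) s s₂ (t₁ + t₂)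
  | branch_true {e : AExp} {p q : Cmd} {s s' : Store} {t : ℕ} :
      e.val s ≠ 0 → Exec p s s' t → Exec (.branch e p q) s s' (e.cost s + 1 + t)
  | branch_false {e : AExp} {p q : Cmd} {s s' : Store} {t : ℕ} :
      e.val s = 0 → Exec q s s' t → Exec (.branch e p q) s s' (e.cost s + 1 + t)
  | loop_done {e : AExp} {p : Cmd} {s : Store} :
      e.val s = 0 → Exec (.loop e p) s s (e.cost s + 1)
  | loop_step {e : AExp} {p : Cmd} {s s₁ s₂ : Store} {t₁ t₂ : ℕ} :
      e.val s ≠ 0 → Exec p s s₁ t₁ → Exec (.loop e p) s₁ s₂ t₂ →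
        Exec (.loop e p) s s₂ (e.cost s + 1 + t₁ + t₂)

open Classical in
/-- The initial store on input `(G, k)`: register 0 holds the number `n` of vertices, register 1
holds `k`, array 0 holds the adjacency matrix of `G` row by row (the entry for `i`, `j` at index
`i * n + j`), and everything else is zero. -/
noncomputable def inputStore {n : ℕ} (G : SimpleGraph (Fin n)) (k : ℕ) : Store where
  reg x := if x = 0 then n else if x = 1 then k else 0
  arr a m :=
    if a = 0 ∧ ∃ i j : Fin n, G.Adj i j ∧ m = (i : ℕ) * n + (j : ℕ) then 1 else 0

end PathContr

namespace PathContr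

universe u

/-! A connected graph contracts to a path on m vertices exactly when its vertices split into m
nonempty connected layers with edges only inside layers or between consecutive ones, and then n - m
contractions suffice. So the question is whether some layering has n ≤ m + k
(`contractibleToPath_iff`). In one direction layerings are pulled back along quotient maps; in the
other, an edge inside a layer is contracted as long as there is one.

Layerings are found by dynamic programming on their prefixes. Put K = min k n. Since all layers are
nonempty, a layer and its two neighbouring layers have at most K + 3 vertices together
(`IsLayering.card_near`), and every neighbour of the layer lies among them. Growing the layer from
one of its vertices v, and deciding once about each neighbour that turns up, therefore takes at most
K + 2 binary decisions (`exists_foldl_growStep`). Hence n · 2^(K+2) pairs of a start vertex and a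
code of decisions produce every layer A that is needed. The prefix L before A need not be
enumerated: it is empty, or it is the component of G - A that contains any chosen vertex x of the
preceding layer. Each round tries all n² · 2^(K+2) triples (v, x, code), and round i appends layer i
to an optimal prefix (`IsLayering.exists_time`, `le_table_of_isLayering`), so n rounds suffice.
Conversely, every table entry is certified by a layering, because L is closed under adjacency
outside A (`HasLayering.append`, `hasLayering_of_table`).

A vertex set is a number below 2^n, used directly as an index into the table, whose untouched
entries are zero. In the main loop all stored numbers have at most 10n bits, and one trial runs two
loops of n³ cheap steps. With n³ · 2^(K+2) trials the total is O(2^k · n^7)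
(`halts_pathContraction`). -/

/-! ### Edge contractions and layerings -/

/-- `S` is connected in `G`: a set closed under adjacency inside `S` contains all or none of `S`. -/
def ConnOn {V : Type u} (G : SimpleGraph V) (S : Set V) : Prop :=
  ∀ T : Set V, (∀ a ∈ S, ∀ b ∈ S, a ∈ T → G.Adj a b → b ∈ T) → ∀ a ∈ S, ∀ b ∈ S, a ∈ T → b ∈ T

/-- `f` places the vertices into consecutive layers `0, …, m - 1` that are nonempty and connected,
and into the layer `m` of the vertices not yet treated; edges join equal or consecutive layers. -/
structure IsLayering {V : Type u} (G : SimpleGraph V) (m : ℕ) (f : V → ℕ) : Prop where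
  le : ∀ x, f x ≤ m
  surj : ∀ i < m, ∃ x, f x = i
  adj : ∀ a b, G.Adj a b → f a ≤ f b + 1
  conn : ∀ i < m, ConnOn G {x | f x = i}

/-- A layering in which every vertex has been placed: a witness for contractibility to a path. -/
def HasPathLayering {V : Type u} (G : SimpleGraph V) (m : ℕ) : Prop :=
  ∃ f : V → ℕ, IsLayering G m f ∧ ∀ x, f x < m

theorem ConnOn.insert {V : Type u} {G : SimpleGraph V} {A : Set V} (hA : ConnOn G A)
    {i j : V} (hi : i ∈ A) (hij : G.Adj i j) :
    ConnOn G (insert j A) := by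
  intro T hT
  have hT' : ∀ a ∈ A, ∀ b ∈ A, a ∈ T → b ∈ T :=
    hA T fun a ha b hb => hT a (Or.inr ha) b (Or.inr hb)
  have h1 : i ∈ T → j ∈ T := fun h => hT i (Or.inr hi) j (Or.inl rfl) h hij
  have h2 : j ∈ T → i ∈ T := fun h => hT j (Or.inl rfl) i (Or.inr hi) h hij.symm
  rintro a (rfl | ha) b (rfl | hb) haT
  · exact haT
  · exact hT' i hi b hb (h2 haT)
  · exact h1 (hT' a ha i hi haT)
  · exact hT' a ha b hb haT

theorem connOn_univ {V : Type u} {G : SimpleGraph V} (h : G.Connected) : ConnOn G Set.univ := by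
  intro T hT a _ b _ ha
  obtain ⟨w⟩ := h.preconnected a b
  clear * - hT w ha
  induction w with
  | nil => exact ha
  | cons hadj _ ih => exact ih (hT _ trivial _ trivial ha hadj)

/-- `π` has the properties of the quotient map of an edge contraction. -/
structure IsContraction {V V' : Type u} (G : SimpleGraph V) (G' : SimpleGraph V') (π : V → V') :
    Prop where
  surj : Function.Surjective π
  map_adj : ∀ a b, G.Adj a b → π a ≠ π b → G'.Adj (π a) (π b)
  lift_adj : ∀ p q, G'.Adj p q → ∃ a b, π a = p ∧ π b = q ∧ G.Adj a b
  fibre : ∀ a b, π a = π b → a = b ∨ G.Adj a b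

/-- Fibres are cliques, so a set closed under adjacency inside the preimage of `S` is saturated
there and descends to the quotient; edges lift, so closedness descends with it. -/
theorem IsContraction.connOn_iff {V V' : Type u} {G : SimpleGraph V} {G' : SimpleGraph V'}
    {π : V → V'} (h : IsContraction G G' π) (S : Set V') :
    ConnOn G (π ⁻¹' S) ↔ ConnOn G' S := by
  constructor
  · intro hc T hT p hp q hq hpT
    obtain ⟨a, rfl⟩ := h.surj p
    obtain ⟨b, rfl⟩ := h.surj q
    refine hc (π ⁻¹' T) ?_ a hp b hq hpT
    intro a ha b hb haT hab
    by_cases hne : π a = π b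
    · simpa [Set.mem_preimage, ← hne] using haT
    · exact hT _ ha _ hb haT (h.map_adj a b hab hne)
  · intro hc T hT a ha b hb haT
    have hsat : ∀ a b, π a = π b → π a ∈ S → a ∈ T → b ∈ T := by
      intro a b hab haS haT
      rcases h.fibre a b hab with rfl | hadj
      · exact haT
      · exact hT a haS b (by simpa [Set.mem_preimage, ← hab] using haS) haT hadj
    have key := hc (π '' (T ∩ π ⁻¹' S)) (by
      rintro p hp q hq ⟨a, ⟨haT, haS⟩, rfl⟩ hpq
      obtain ⟨a', b', ha', rfl, hab⟩ := h.lift_adj _ _ hpq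
      exact ⟨b', ⟨hT a' (by simpa [Set.mem_preimage, ha'] using haS) b' hq
        (hsat a a' ha'.symm haS haT) hab, hq⟩, rfl⟩) (π a) ha (π b) hb ⟨a, ⟨haT, ha⟩, rfl⟩
    obtain ⟨b', ⟨hbT, hbS⟩, hbb⟩ := key
    exact hsat b' b hbb hbS hbT

theorem IsContraction.isLayering_iff {V V' : Type u} {G : SimpleGraph V} {G' : SimpleGraph V'}
    {π : V → V'} (h : IsContraction G G' π) (m : ℕ) (f : V' → ℕ) :
    IsLayering G m (f ∘ π) ↔ IsLayering G' m f := by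
  constructor
  · intro hf
    refine ⟨fun x => ?_, fun i hi => ?_, fun p q hpq => ?_, fun i hi => ?_⟩
    · obtain ⟨a, rfl⟩ := h.surj x
      exact hf.le a
    · obtain ⟨a, ha⟩ := hf.surj i hi
      exact ⟨π a, ha⟩
    · obtain ⟨a, b, rfl, rfl, hab⟩ := h.lift_adj p q hpq
      exact hf.adj a b hab
    · exact (h.connOn_iff _).1 (hf.conn i hi)
  · intro hf
    refine ⟨fun x => hf.le _, fun i hi => ?_, fun a b hab => ?_, fun i hi => ?_⟩
    · obtain ⟨p, hp⟩ := hf.surj i hi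
      obtain ⟨a, rfl⟩ := h.surj p
      exact ⟨a, hp⟩
    · by_cases hne : π a = π b
      · simp [hne]
      · exact hf.adj _ _ (h.map_adj a b hab hne)
    · exact (h.connOn_iff {x | f x = i}).2 (hf.conn i hi)

open Classical in
/-- The map from the vertices of `G` to those of the contracted graph. -/
noncomputable def contractMap {V : Type u} (u v : V) (x : V) :
    {x : Option V // x ≠ some u ∧ x ≠ some v} :=
  if h : x = u ∨ x = v then ⟨none, by simp⟩
  else ⟨some x, by simpa [not_or] using h⟩

theorem isContraction_contractMap {V : Type u} {G : SimpleGraph V} {u v : V} (huv : G.Adj u v) :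
    IsContraction G (contractEdge G u v) (contractMap u v) := by
  refine ⟨?_, ?_, ?_, ?_⟩
  · rintro ⟨_ | x, hx⟩
    · exact ⟨u, by simp [contractMap]⟩
    · refine ⟨x, ?_⟩
      have : ¬ (x = u ∨ x = v) := by simpa [not_or] using hx
      simp [contractMap, this]
  · intro a b hab hne
    by_cases ha : a = u ∨ a = v <;> by_cases hb : b = u ∨ b = v
    · exact absurd (by simp [contractMap, ha, hb]) hne
    · simp only [contractMap, ha, hb, dif_pos, dif_neg, not_false_eq_true, contractEdge]
      rcases ha with rfl | rfl
      · exact Or.inl hab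
      · exact Or.inr hab
    · simp only [contractMap, ha, hb, dif_pos, dif_neg, not_false_eq_true, contractEdge]
      rcases hb with rfl | rfl
      · exact Or.inl hab.symm
      · exact Or.inr hab.symm
    · simpa only [contractMap, ha, hb, dif_neg, not_false_eq_true, contractEdge] using hab
  · have hsome : ∀ x (hx : some x ≠ some u ∧ some x ≠ some v),
        contractMap u v x = ⟨some x, hx⟩ := by
      intro x hx
      have : ¬ (x = u ∨ x = v) := by simpa [not_or] using hx
      simp [contractMap, this]
    have hu : contractMap u v u = ⟨none, by simp⟩ := by simp [contractMap]
    have hv : contractMap u v v = ⟨none, by simp⟩ := by simp [contractMap]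
    rintro ⟨_ | x, hx⟩ ⟨_ | y, hy⟩ h
    · exact h.elim
    · rcases h with h | h
      · exact ⟨u, y, hu, hsome y hy, h⟩
      · exact ⟨v, y, hv, hsome y hy, h⟩
    · rcases h with h | h
      · exact ⟨x, u, hsome x hx, hu, h.symm⟩
      · exact ⟨x, v, hsome x hx, hv, h.symm⟩
    · exact ⟨x, y, hsome x hx, hsome y hy, h⟩
  · intro a b hab
    by_cases ha : a = u ∨ a = v <;> by_cases hb : b = u ∨ b = v
    · rcases ha with rfl | rfl <;> rcases hb with rfl | rfl
      · exact Or.inl rfl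
      · exact Or.inr huv
      · exact Or.inr huv.symm
      · exact Or.inl rfl
    · simp [contractMap, ha, hb] at hab
    · simp [contractMap, ha, hb] at hab
    · simp only [contractMap, ha, hb, dif_neg, not_false_eq_true, Subtype.mk.injEq,
        Option.some.injEq] at hab
      exact Or.inl hab

theorem card_contract {V : Type u} [Finite V] {u v : V} (huv : u ≠ v) :
    Nat.card {x : Option V // x ≠ some u ∧ x ≠ some v} + 1 = Nat.card V := by
  classical
  have := Fintype.ofFinite V
  rw [Nat.card_eq_fintype_card, Nat.card_eq_fintype_card,
    Fintype.card_of_subtype (({some u, some v} : Finset (Option V))ᶜ) (by simp)]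
  rw [Finset.card_compl, Finset.card_pair (by simpa using huv), Fintype.card_option]
  have : 1 < Fintype.card V := Fintype.one_lt_card_iff.2 ⟨u, v, huv⟩
  omega

/-- In a connected graph consecutive layers are joined by an edge. -/
theorem IsLayering.exists_adj {V : Type u} {G : SimpleGraph V} (hG : ConnOn G Set.univ) {m : ℕ}
    {f : V → ℕ} (hf : IsLayering G m f) {i : ℕ} {y : V} (hi : i < m) (hy : f y = i + 1) :
    ∃ a b, G.Adj a b ∧ f a = i ∧ f b = i + 1 := by
  by_contra! hno
  obtain ⟨x, hx⟩ := hf.surj i hi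
  have := hG {x | f x ≤ i} (by
    intro a _ b _ (ha : f a ≤ i) hab
    have h1 := hf.adj b a hab.symm
    have h2 := hno a b hab
    show f b ≤ i
    by_contra hb
    exact h2 (by omega) (by omega)) x trivial y trivial (show f x ≤ i by omega)
  have : f y ≤ i := this
  omega

/-- With one vertex per layer, the edge that connectedness of `G` forces between consecutive layers
must join their unique vertices. -/
theorem HasPathLayering.isPathGraph {V : Type u} {G : SimpleGraph V} [Nonempty V]
    (hG : ConnOn G Set.univ) {m : ℕ} {f : V → ℕ} (hf : IsLayering G m f) (hlt : ∀ x, f x < m)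
    (hinj : Function.Injective f) : IsPathGraph G := by
  refine ⟨m, Nat.pos_of_ne_zero fun h => ?_, ⟨?_⟩⟩
  · obtain ⟨x⟩ := ‹Nonempty V›
    have := hlt x
    omega
  · let e : V ≃ Fin m := Equiv.ofBijective (fun x => ⟨f x, hlt x⟩)
      ⟨fun a b h => hinj (by simpa using h), fun i => by
        obtain ⟨x, hx⟩ := hf.surj i i.2
        exact ⟨x, Fin.ext hx⟩⟩
    have hcons : ∀ a b, f a + 1 = f b → G.Adj a b := by
      intro a b hab
      obtain ⟨a', b', hadj, ha, hb⟩ := hf.exists_adj hG (hlt a) hab.symm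
      rwa [← hinj ha, hinj (hab.symm.trans hb.symm)]
    refine ⟨e, ?_⟩
    intro a b
    rw [SimpleGraph.pathGraph_adj]
    change f a + 1 = f b ∨ f b + 1 = f a ↔ G.Adj a b
    constructor
    · rintro (h | h)
      · exact hcons a b h
      · exact (hcons b a h).symm
    · intro h
      have h1 := hf.adj a b h
      have h2 := hf.adj b a h.symm
      have h3 : f a ≠ f b := fun he => h.ne (hinj he)
      omega

theorem lt_card_of_layering {V : Type u} [Finite V] {G : SimpleGraph V} {m : ℕ} {f : V → ℕ}
    (hf : IsLayering G m f) (hlt : ∀ x, f x < m) (hinj : ¬ Function.Injective f) :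
    m < Nat.card V := by
  let g : V → Fin m := fun x => ⟨f x, hlt x⟩
  have hg : Function.Surjective g := fun i => by
    obtain ⟨x, hx⟩ := hf.surj i i.2
    exact ⟨x, Fin.ext hx⟩
  have h1 : m ≤ Nat.card V := by simpa using Nat.card_le_card_of_surjective g hg
  refine lt_of_le_of_ne h1 fun h => hinj ?_
  have : Function.Bijective g :=
    (Nat.bijective_iff_surjective_and_card g).2 ⟨hg, by simpa using h.symm⟩
  intro a b hab
  exact this.1 (Fin.ext hab)

theorem IsPathGraph.hasPathLayering {V : Type u} {G : SimpleGraph V} (h : IsPathGraph G) :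
    ∃ m, HasPathLayering G m ∧ Nat.card V = m := by
  obtain ⟨m, -, ⟨e⟩⟩ := h
  refine ⟨m, ⟨fun x => e x, ⟨fun x => (e x).2.le, fun i hi => ⟨e.symm ⟨i, hi⟩, by simp⟩, ?_, ?_⟩,
    fun x => (e x).2⟩, by simpa using Nat.card_congr e.toEquiv⟩
  · intro a b hab
    have := e.map_rel_iff.2 hab
    rw [SimpleGraph.pathGraph_adj] at this
    omega
  · intro i _ T _ a ha b hb haT
    have : a = b := e.injective (Fin.ext (by
      rw [show ((e a : Fin m) : ℕ) = i from ha, show ((e b : Fin m) : ℕ) = i from hb]))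
    exact this ▸ haT

/-- Composing with the quotient map keeps the number of layers, while undoing a contraction adds
exactly one vertex. -/
theorem ContractibleToPath.hasPathLayering (k : ℕ) :
    ∀ {V : Type u} [Finite V] {G : SimpleGraph V}, ContractibleToPath k G →
      ∃ m, HasPathLayering G m ∧ Nat.card V ≤ m + k := by
  induction k with
  | zero =>
    intro V _ G h
    obtain ⟨m, h1, h2⟩ := IsPathGraph.hasPathLayering h
    exact ⟨m, h1, h2.le⟩
  | succ k ih =>
    intro V _ G h
    rcases h with h | ⟨u, v, huv, h⟩
    · obtain ⟨m, h1, h2⟩ := IsPathGraph.hasPathLayering h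
      exact ⟨m, h1, by omega⟩
    · obtain ⟨m, ⟨f, hf, hlt⟩, hc⟩ := ih h
      refine ⟨m, ⟨_, ((isContraction_contractMap huv).isLayering_iff m f).2 hf, fun x => hlt _⟩, ?_⟩
      have := card_contract huv.ne
      omega

/-- Contracting an edge inside a layer preserves m and lowers the number of vertices by one. With no
contraction left, n ≤ m makes the layering injective. -/
theorem HasPathLayering.contractibleToPath (k : ℕ) :
    ∀ {V : Type u} [Finite V] [Nonempty V] {G : SimpleGraph V}, ConnOn G Set.univ →
      ∀ m, HasPathLayering G m → Nat.card V ≤ m + k → ContractibleToPath k G := by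
  induction k with
  | zero =>
    intro V _ _ G hG m ⟨f, hf, hlt⟩ hc
    refine HasPathLayering.isPathGraph hG hf hlt ?_
    by_contra h
    have := lt_card_of_layering hf hlt h
    omega
  | succ k ih =>
    intro V _ _ G hG m ⟨f, hf, hlt⟩ hc
    by_cases hinj : Function.Injective f
    · exact Or.inl (HasPathLayering.isPathGraph hG hf hlt hinj)
    · right
      obtain ⟨u, v, huv, hfuv⟩ : ∃ u v, G.Adj u v ∧ f u = f v := by
        by_contra! hno
        refine hinj fun a b hab => ?_
        -- If no edge lies inside a layer, each singleton is closed under adjacency in its layer, so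
        -- a connected layer has only one vertex.
        have := hf.conn (f b) (hlt b) {a} (by
          rintro x hx y hy rfl hxy
          exact absurd (Eq.trans hx (Eq.symm hy)) (hno _ _ hxy)) a hab b rfl rfl
        exact (this : b = a).symm
      refine ⟨u, v, huv, ?_⟩
      have hπ := isContraction_contractMap huv
      have hcard := card_contract huv.ne
      have : Nonempty {x : Option V // x ≠ some u ∧ x ≠ some v} := ⟨contractMap u v u⟩
      obtain ⟨f', hf'⟩ : ∃ f' : {x : Option V // x ≠ some u ∧ x ≠ some v} → ℕ,
          f = f' ∘ contractMap u v := by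
        refine ⟨fun p => f (Function.surjInv hπ.surj p), funext fun x => ?_⟩
        have hx := Function.surjInv_eq hπ.surj (contractMap u v x)
        have : ∀ a b, contractMap u v a = contractMap u v b → f a = f b := by
          intro a b hab
          by_cases ha : a = u ∨ a = v <;> by_cases hb : b = u ∨ b = v
          · rcases ha with rfl | rfl <;> rcases hb with rfl | rfl <;> simp [hfuv]
          · simp [contractMap, ha, hb] at hab
          · simp [contractMap, ha, hb] at hab
          · simp only [contractMap, ha, hb, dif_neg, not_false_eq_true, Subtype.mk.injEq,
              Option.some.injEq] at hab
            rw [hab]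
        exact this _ _ hx.symm
      subst hf'
      refine ih ((hπ.connOn_iff Set.univ).1 hG) m ⟨f', (hπ.isLayering_iff m f').1 hf, ?_⟩ (by omega)
      intro p
      obtain ⟨a, rfl⟩ := hπ.surj p
      exact hlt a

theorem contractibleToPath_iff {V : Type u} [Finite V] {G : SimpleGraph V} (hG : G.Connected)
    (k : ℕ) : ContractibleToPath k G ↔ ∃ m, HasPathLayering G m ∧ Nat.card V ≤ m + k := by
  have := hG.nonempty
  exact ⟨ContractibleToPath.hasPathLayering k, fun ⟨m, h1, h2⟩ =>
    HasPathLayering.contractibleToPath k (connOn_univ hG) m h1 h2⟩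

/-! ### Logarithmic cost of programs -/

/-- Every number in the store has at most `b` binary digits. -/
def Store.Bounded (s : Store) (b : ℕ) : Prop :=
  (∀ x, (s.reg x).size ≤ b) ∧ ∀ a i, (s.arr a i).size ≤ b

theorem Op.size_apply (o : Op) (a b : ℕ) : (o.apply a b).size ≤ a.size + b.size + 1 := by
  have ha := Nat.lt_size_self a
  have hb := Nat.lt_size_self b
  rw [Nat.size_le]
  have h1 : 2 ^ a.size ≤ 2 ^ (a.size + b.size) := Nat.pow_le_pow_right (by norm_num) (by omega)
  have h2 : 2 ^ b.size ≤ 2 ^ (a.size + b.size) := Nat.pow_le_pow_right (by norm_num) (by omega)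
  have h3 : 2 ^ (a.size + b.size + 1) = 2 * 2 ^ (a.size + b.size) := by ring
  cases o
  · simp only [Op.apply]; omega
  · simp only [Op.apply]; omega
  · simp only [Op.apply]
    have : a * b ≤ 2 ^ a.size * 2 ^ b.size := Nat.mul_le_mul ha.le hb.le
    rw [← pow_add] at this
    have := Nat.two_pow_pos (a.size + b.size)
    omega
  · simp only [Op.apply]
    have := Nat.div_le_self a b
    omega

/-- The constant depends on the expression alone: each of its finitely many operations at most adds
the lengths of its arguments, up to one bit, and each entry read has length at most `b`. -/
theorem AExp.exists_bound (e : AExp) : ∃ K : ℕ, ∀ (s : Store) (b : ℕ), 1 ≤ b → s.Bounded b →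
    (e.val s).size ≤ K * b ∧ e.cost s ≤ K * b := by
  induction e with
  | lit c =>
    refine ⟨1 + c.size, fun s b hb _ => ?_⟩
    simp only [AExp.val, AExp.cost]
    constructor <;> nlinarith
  | reg x =>
    refine ⟨2, fun s b hb h => ?_⟩
    have := h.1 x
    simp only [AExp.val, AExp.cost]
    omega
  | load a i ih =>
    obtain ⟨K, hK⟩ := ih
    refine ⟨2 * K + 2, fun s b hb h => ?_⟩
    obtain ⟨h1, h2⟩ := hK s b hb h
    have := h.2 a (i.val s)
    simp only [AExp.val, AExp.cost]
    constructor <;> nlinarith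
  | op o e₁ e₂ ih₁ ih₂ =>
    obtain ⟨K₁, hK₁⟩ := ih₁
    obtain ⟨K₂, hK₂⟩ := ih₂
    refine ⟨3 * K₁ + 3 * K₂ + 2, fun s b hb h => ?_⟩
    obtain ⟨h1, h2⟩ := hK₁ s b hb h
    obtain ⟨h3, h4⟩ := hK₂ s b hb h
    have := o.size_apply (e₁.val s) (e₂.val s)
    simp only [AExp.val, AExp.cost]
    constructor <;> nlinarith

/-- Programs without loops. -/
def Cmd.LoopFree : Cmd → Prop
  | .skip => True
  | .assign _ _ => True
  | .store _ _ _ => True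
  | .seq p q => p.LoopFree ∧ q.LoopFree
  | .branch _ p q => p.LoopFree ∧ q.LoopFree
  | .loop _ _ => False

/-- The final store of a program without loops. -/
def Cmd.run : Cmd → Store → Store
  | .skip, s => s
  | .assign x e, s => s.setReg x (e.val s)
  | .store a i e, s => s.setArr a (i.val s) (e.val s)
  | .seq p q, s => q.run (p.run s)
  | .branch e p q, s => if e.val s ≠ 0 then p.run s else q.run s
  | .loop _ _, s => s

theorem Store.Bounded.mono {s : Store} {b c : ℕ} (h : s.Bounded b) (hbc : b ≤ c) : s.Bounded c :=
  ⟨fun x => (h.1 x).trans hbc, fun a i => (h.2 a i).trans hbc⟩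

theorem Store.Bounded.setReg {s : Store} {b : ℕ} (h : s.Bounded b) (x : ℕ) {v : ℕ}
    (hv : v.size ≤ b) : (s.setReg x v).Bounded b := by
  refine ⟨fun y => ?_, h.2⟩
  simp only [Store.setReg, Function.update_apply]
  split_ifs
  · exact hv
  · exact h.1 y

theorem Store.Bounded.setArr {s : Store} {b : ℕ} (h : s.Bounded b) (a i : ℕ) {v : ℕ}
    (hv : v.size ≤ b) : (s.setArr a i v).Bounded b := by
  refine ⟨h.1, fun a' i' => ?_⟩
  simp only [Store.setArr, Function.update_apply]
  split_ifs
  · simp only [Function.update_apply]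
    split_ifs
    · exact hv
    · exact h.2 a i'
  · exact h.2 a' i'

/-- Lengths may grow by a constant factor with each command, so the second half of a sequence is
charged for the enlarged bound. Without loops there are boundedly many such factors. -/
theorem Cmd.LoopFree.exec {p : Cmd} (hp : p.LoopFree) : ∃ K : ℕ, ∀ (s : Store) (b : ℕ), 1 ≤ b →
    s.Bounded b → (∃ t, Exec p s (p.run s) t ∧ t ≤ K * b) ∧ (p.run s).Bounded ((K + 1) * b) := by
  induction p with
  | skip =>
    exact ⟨1, fun s b hb h => ⟨⟨1, Exec.skip s, by omega⟩, h.mono (by omega)⟩⟩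
  | assign x e =>
    obtain ⟨K, hK⟩ := e.exists_bound
    refine ⟨2 * K + 1, fun s b hb h => ?_⟩
    obtain ⟨h1, h2⟩ := hK s b hb h
    refine ⟨⟨_, Exec.assign s x e, by nlinarith⟩, ?_⟩
    exact (h.mono (by nlinarith)).setReg x (by nlinarith)
  | store a i e =>
    obtain ⟨K, hK⟩ := e.exists_bound
    obtain ⟨K', hK'⟩ := i.exists_bound
    refine ⟨2 * K + 2 * K' + 1, fun s b hb h => ?_⟩
    obtain ⟨h1, h2⟩ := hK s b hb h
    obtain ⟨h3, h4⟩ := hK' s b hb h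
    refine ⟨⟨_, Exec.store s a i e, by nlinarith⟩, ?_⟩
    exact (h.mono (by nlinarith)).setArr a _ (by nlinarith)
  | seq p q ihp ihq =>
    obtain ⟨K, hK⟩ := ihp hp.1
    obtain ⟨K', hK'⟩ := ihq hp.2
    refine ⟨K + K' * (K + 1) + K, fun s b hb h => ?_⟩
    obtain ⟨⟨t, h1, h2⟩, h3⟩ := hK s b hb h
    obtain ⟨⟨t', h4, h5⟩, h6⟩ := hK' (p.run s) ((K + 1) * b) (by nlinarith) h3
    refine ⟨⟨_, h1.seq h4, by nlinarith⟩, h6.mono (by nlinarith)⟩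
  | branch e p q ihp ihq =>
    obtain ⟨K, hK⟩ := ihp hp.1
    obtain ⟨K', hK'⟩ := ihq hp.2
    obtain ⟨C, hC⟩ := e.exists_bound
    refine ⟨K + K' + C + 1, fun s b hb h => ?_⟩
    obtain ⟨⟨t, h1, h2⟩, h3⟩ := hK s b hb h
    obtain ⟨⟨t', h4, h5⟩, h6⟩ := hK' s b hb h
    obtain ⟨-, h7⟩ := hC s b hb h
    simp only [Cmd.run]
    split_ifs with hv
    · exact ⟨⟨_, Exec.branch_true hv h1, by nlinarith⟩, h3.mono (by nlinarith)⟩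
    · exact ⟨⟨_, Exec.branch_false (by simpa using hv) h4, by nlinarith⟩, h6.mono (by nlinarith)⟩
  | loop e p => exact hp.elim

/-- `p` halts from `s` within time `T` in a store satisfying `Q`. -/
def Halts (p : Cmd) (s : Store) (T : ℕ) (Q : Store → Prop) : Prop :=
  ∃ s' t, Exec p s s' t ∧ t ≤ T ∧ Q s'

theorem Halts.seq {p q : Cmd} {s : Store} {T T' : ℕ} {R Q : Store → Prop} (hp : Halts p s T R)
    (hq : ∀ s', R s' → Halts q s' T' Q) : Halts (.seq p q) s (T + T') Q := by
  obtain ⟨s₁, t₁, h1, h2, h3⟩ := hp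
  obtain ⟨s₂, t₂, h4, h5, h6⟩ := hq s₁ h3
  exact ⟨s₂, _, h1.seq h4, by omega, h6⟩

theorem Halts.mono {p : Cmd} {s : Store} {T T' : ℕ} {R Q : Store → Prop} (hp : Halts p s T R)
    (hT : T ≤ T') (hQ : ∀ s', R s' → Q s') : Halts p s T' Q := by
  obtain ⟨s₁, t₁, h1, h2, h3⟩ := hp
  exact ⟨s₁, t₁, h1, h2.trans hT, hQ _ h3⟩

theorem Cmd.LoopFree.halts {p : Cmd} (hp : p.LoopFree) : ∃ K : ℕ, ∀ (s : Store) (b : ℕ), 1 ≤ b →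
    s.Bounded b → Halts p s (K * b) (· = p.run s) := by
  obtain ⟨K, hK⟩ := hp.exec
  refine ⟨K, fun s b hb h => ?_⟩
  obtain ⟨⟨t, h1, h2⟩, -⟩ := hK s b hb h
  exact ⟨_, t, h1, h2, rfl⟩

/-- The invariant is indexed by the number of completed iterations. The summand `C + 1` pays for the
last, failing evaluation of the guard. -/
theorem halts_loop {e : AExp} {p : Cmd} (I : ℕ → Store → Prop) {N T C : ℕ}
    (hguard : ∀ i s, I i s → i ≤ N → (e.val s ≠ 0 ↔ i < N))
    (hcost : ∀ i s, I i s → i ≤ N → e.cost s ≤ C)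
    (hstep : ∀ i s, i < N → I i s → Halts p s T (I (i + 1))) {s : Store} (h0 : I 0 s) :
    Halts (.loop e p) s (N * (T + C + 1) + C + 1) (I N) := by
  have key : ∀ d i s, i + d = N → I i s →
      Halts (.loop e p) s (d * (T + C + 1) + C + 1) (I N) := by
    intro d
    induction d with
    | zero =>
      intro i s hi hs
      obtain rfl : i = N := by omega
      have hv : e.val s = 0 := by
        by_contra h
        exact lt_irrefl _ ((hguard i s hs le_rfl).1 h)
      exact ⟨s, _, Exec.loop_done hv, by have := hcost i s hs le_rfl; omega, hs⟩
    | succ d ih =>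
      intro i s hi hs
      obtain ⟨s₁, t₁, h1, h2, h3⟩ := hstep i s (by omega) hs
      obtain ⟨s₂, t₂, h4, h5, h6⟩ := ih (i + 1) s₁ (by omega) h3
      refine ⟨s₂, _, Exec.loop_step ((hguard i s hs (by omega)).2 (by omega)) h1 h4, ?_, h6⟩
      have := hcost i s hs (by omega)
      have : (d + 1) * (T + C + 1) = d * (T + C + 1) + (T + C + 1) := by ring
      omega
  exact key N 0 s (by omega) h0

/-! ### Sets of vertices as numbers -/

/-- The number whose binary digits are the indicator function of `S`. -/
def mask {n : ℕ} (S : Finset (Fin n)) : ℕ := ∑ i ∈ S, 2 ^ (i : ℕ)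

theorem bitIndices_mask {n : ℕ} (S : Finset (Fin n)) :
    (mask S).bitIndices.toFinset = S.map Fin.valEmbedding := by
  have : mask S = ∑ i ∈ S.map Fin.valEmbedding, 2 ^ i := by simp [mask]
  rw [this, Finset.toFinset_bitIndices_sum_two_pow]

/-- This is the membership test available to the machine, which has division but no bit operations.
-/
theorem mask_div_mod {n : ℕ} (S : Finset (Fin n)) (j : Fin n) :
    mask S / 2 ^ (j : ℕ) % 2 = if j ∈ S then 1 else 0 := by
  have h : (j : ℕ) ∈ (mask S).bitIndices.toFinset ↔ j ∈ S := by
    rw [bitIndices_mask]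
    simp [Fin.val_inj]
  rw [List.mem_toFinset, Nat.mem_bitIndices, Nat.testBit_eq_decide_div_mod_eq,
    decide_eq_true_iff] at h
  split_ifs with hj
  · exact h.2 hj
  · have := mt h.1 hj
    omega

theorem mask_injective {n : ℕ} : Function.Injective (mask (n := n)) := by
  intro S T h
  have := bitIndices_mask S
  rw [h, bitIndices_mask] at this
  exact (Finset.map_injective _ this).symm

theorem mask_insert {n : ℕ} {S : Finset (Fin n)} {j : Fin n} (h : j ∉ S) :
    mask (insert j S) = mask S + 2 ^ (j : ℕ) := by
  rw [mask, Finset.sum_insert h, add_comm, mask]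

theorem mask_singleton {n : ℕ} (v : Fin n) : mask {v} = 2 ^ (v : ℕ) := Finset.sum_singleton _ _

theorem mask_union {n : ℕ} {S T : Finset (Fin n)} (h : Disjoint S T) :
    mask (S ∪ T) = mask S + mask T := Finset.sum_union h

theorem mask_univ (n : ℕ) : mask (Finset.univ : Finset (Fin n)) = 2 ^ n - 1 := by
  rw [mask, Fin.sum_univ_eq_sum_range (fun i => 2 ^ i) n, Nat.geomSum_eq le_rfl]
  simp

theorem mask_lt {n : ℕ} (S : Finset (Fin n)) : mask S < 2 ^ n := by
  have h : mask S ≤ mask (Finset.univ : Finset (Fin n)) :=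
    Finset.sum_le_sum_of_subset (Finset.subset_univ S)
  rw [mask_univ] at h
  have := Nat.two_pow_pos n
  omega

/-! ### Closures and enumeration of connected sets -/

section closure

variable {V : Type u} [DecidableEq V] (G : SimpleGraph V)

open Classical in
/-- Add the second vertex of a pair to `L` if it is a neighbour of the first and allowed. -/
noncomputable def closeStep (M L : Finset V) (p : V × V) : Finset V :=
  if p.1 ∈ L ∧ G.Adj p.1 p.2 ∧ p.2 ∉ L ∧ p.2 ∈ M then insert p.2 L else L

open Classical in
/-- One step of the enumeration. The state consists of a connected set, the set of vertices already
decided upon, and a number whose binary digits tell how to decide. -/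
noncomputable def growStep (s : Finset V × Finset V × ℕ) (p : V × V) : Finset V × Finset V × ℕ :=
  if p.1 ∈ s.1 ∧ G.Adj p.1 p.2 ∧ p.2 ∉ s.2.1 then
    (if s.2.2 % 2 = 1 then insert p.2 s.1 else s.1, insert p.2 s.2.1, s.2.2 / 2)
  else s

/-- `L` contains every neighbour in `M` of its elements. -/
def ClosedIn (M L : Finset V) : Prop := ∀ a ∈ L, ∀ b ∈ M, G.Adj a b → b ∈ L

variable {G}

theorem subset_closeStep (M L : Finset V) (p : V × V) : L ⊆ closeStep G M L p := by
  unfold closeStep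
  split_ifs
  · exact Finset.subset_insert _ _
  · exact subset_rfl

theorem closeStep_subset {M L T : Finset V} (hL : L ⊆ T) (hT : ClosedIn G M T) (p : V × V) :
    closeStep G M L p ⊆ T := by
  unfold closeStep
  split_ifs with h
  · exact Finset.insert_subset (hT _ (hL h.1) _ h.2.2.2 h.2.1) hL
  · exact hL

theorem subset_foldl_closeStep (M : Finset V) (l : List (V × V)) :
    ∀ L, L ⊆ l.foldl (closeStep G M) L := by
  induction l with
  | nil => exact fun L => subset_rfl
  | cons p l ih => exact fun L => (subset_closeStep M L p).trans (ih _)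

theorem foldl_closeStep_subset {M T : Finset V} (hT : ClosedIn G M T) (l : List (V × V)) :
    ∀ L, L ⊆ T → l.foldl (closeStep G M) L ⊆ T := by
  induction l with
  | nil => exact fun L hL => hL
  | cons p l ih => exact fun L hL => ih _ (closeStep_subset hL hT p)

theorem mem_closeStep {M L : Finset V} {a b : V} (ha : a ∈ L) (hb : b ∈ M) (hab : G.Adj a b) :
    b ∈ closeStep G M L (a, b) := by
  unfold closeStep
  split_ifs with h
  · exact Finset.mem_insert_self _ _
  · by_contra hbL
    exact h ⟨ha, hab, hbL, hb⟩

/-- Every connected set can be reached by a suitable sequence of decisions, which is coded by a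
number that is small if few decisions have to be taken. -/
theorem exists_foldl_growStep {W U : Finset V} (hU : ∀ a ∈ W, ∀ b, G.Adj a b → b ∈ U)
    (l : List (V × V)) : ∀ A F : Finset V, A ⊆ W → (∀ w ∈ W, w ∈ F ↔ w ∈ A) →
      ∃ c < 2 ^ (U \ F).card,
        (l.foldl (growStep G) (A, F, c)).1 = l.foldl (closeStep G W) A := by
  induction l with
  | nil => exact fun A F _ _ => ⟨0, Nat.two_pow_pos _, rfl⟩
  | cons p l ih =>
    intro A F hA hF
    by_cases hp : p.1 ∈ A ∧ G.Adj p.1 p.2 ∧ p.2 ∉ F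
    · have hpU : p.2 ∈ U \ F := by
        rw [Finset.mem_sdiff]
        exact ⟨hU _ (hA hp.1) _ hp.2.1, hp.2.2⟩
      have hcard : (U \ F).card = (U \ insert p.2 F).card + 1 := by
        rw [Finset.sdiff_insert, Finset.card_erase_add_one hpU]
      by_cases hW : p.2 ∈ W
      -- The code is built from its low end: the digit for the present decision is put below the
      -- code for the remaining pairs. As `p.2` leaves `U \ F`, the bound doubles accordingly.
      · obtain ⟨c, hc, h⟩ := ih (insert p.2 A) (insert p.2 F) (Finset.insert_subset hW hA) (by
          intro w hw
          simp only [Finset.mem_insert, hF w hw])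
        refine ⟨2 * c + 1, by rw [hcard, pow_succ]; omega, ?_⟩
        have hpA : p.2 ∉ A := fun h => hp.2.2 ((hF _ hW).2 h)
        have h1 : growStep G (A, F, 2 * c + 1) p = (insert p.2 A, insert p.2 F, c) := by
          rw [growStep, if_pos hp]
          simp only [show (2 * c + 1) % 2 = 1 by omega, if_true,
            show (2 * c + 1) / 2 = c by omega]
        rw [List.foldl_cons, List.foldl_cons, h1, h, closeStep,
          if_pos ⟨hp.1, hp.2.1, hpA, hW⟩]
      · obtain ⟨c, hc, h⟩ := ih A (insert p.2 F) hA (by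
          intro w hw
          have : w ≠ p.2 := fun h => hW (h ▸ hw)
          simp only [Finset.mem_insert, hF w hw, this, false_or])
        refine ⟨2 * c, by rw [hcard, pow_succ]; omega, ?_⟩
        have h1 : growStep G (A, F, 2 * c) p = (A, insert p.2 F, c) := by
          rw [growStep, if_pos hp]
          simp only [show (2 * c) % 2 ≠ 1 by omega, if_false, show (2 * c) / 2 = c by omega]
        rw [List.foldl_cons, List.foldl_cons, h1, h, closeStep, if_neg (fun h => hW h.2.2.2)]
    · obtain ⟨c, hc, h⟩ := ih A F hA hF
      refine ⟨c, hc, ?_⟩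
      rw [List.foldl_cons, List.foldl_cons, growStep, if_neg hp, h, closeStep, if_neg]
      exact fun h => hp ⟨h.1, h.2.1, fun h' => h.2.2.1 ((hF _ h.2.2.2).1 h')⟩

theorem growStep_subset {s : Finset V × Finset V × ℕ} (h : s.1 ⊆ s.2.1) (p : V × V) :
    (growStep G s p).1 ⊆ (growStep G s p).2.1 := by
  unfold growStep
  split_ifs
  · exact Finset.insert_subset_insert _ h
  · exact h.trans (Finset.subset_insert _ _)
  · exact h

theorem growStep_connOn {s : Finset V × Finset V × ℕ} (h : ConnOn G (s.1 : Set V)) (p : V × V) :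
    ConnOn G ((growStep G s p).1 : Set V) := by
  unfold growStep
  split_ifs with hp hc
  · simp only [Finset.coe_insert]
    exact h.insert hp.1 hp.2.1
  · exact h
  · exact h

theorem foldl_growStep_connOn (l : List (V × V)) : ∀ s : Finset V × Finset V × ℕ,
    ConnOn G (s.1 : Set V) → ConnOn G ((l.foldl (growStep G) s).1 : Set V) := by
  induction l with
  | nil => exact fun s hs => hs
  | cons p l ih => exact fun s hs => ih _ (growStep_connOn hs p)

theorem growStep_fst_subset (s : Finset V × Finset V × ℕ) (p : V × V) :
    s.1 ⊆ (growStep G s p).1 := by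
  unfold growStep
  split_ifs
  · exact Finset.subset_insert _ _
  · exact subset_rfl
  · exact subset_rfl

theorem fst_subset_foldl_growStep (l : List (V × V)) : ∀ s : Finset V × Finset V × ℕ,
    s.1 ⊆ (l.foldl (growStep G) s).1 := by
  induction l with
  | nil => exact fun s => subset_rfl
  | cons p l ih => exact fun s => (growStep_fst_subset s p).trans (ih _)

theorem growStep_snd_snd_le (s : Finset V × Finset V × ℕ) (p : V × V) :
    (growStep G s p).2.2 ≤ s.2.2 := by
  unfold growStep
  split_ifs
  · exact Nat.div_le_self _ _
  · exact Nat.div_le_self _ _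
  · exact le_rfl

end closure

/-! ### Running through all pairs of vertices -/

/-- The pair of vertices treated at time `t`. -/
def pairAt (n : ℕ) [NeZero n] (t : ℕ) : Fin n × Fin n := (Fin.ofNat n (t / n), Fin.ofNat n t)

/-- The pairs of vertices treated before time `t`. -/
def pairs (n : ℕ) [NeZero n] (t : ℕ) : List (Fin n × Fin n) := (List.range t).map (pairAt n)

theorem foldl_pairs_succ {n : ℕ} [NeZero n] {α : Type*} (f : α → Fin n × Fin n → α) (a : α)
    (t : ℕ) : (pairs n (t + 1)).foldl f a = f ((pairs n t).foldl f a) (pairAt n t) := by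
  simp [pairs, List.range_succ]

theorem exists_pairAt {n : ℕ} [NeZero n] (p : ℕ) (a b : Fin n) :
    ∃ s, p * (n * n) ≤ s ∧ s < (p + 1) * (n * n) ∧ pairAt n s = (a, b) := by
  have ha := a.2
  have hb := b.2
  have h0 : 0 < n := by omega
  have h1 : (a : ℕ) * n + b < n * n := by nlinarith
  refine ⟨p * (n * n) + (a * n + b), by omega, by linarith, ?_⟩
  have h2 : p * (n * n) + (a * n + b) = b + n * (a + n * p) := by ring
  have h3 : (p * (n * n) + (a * n + b)) / n = a + n * p := by
    rw [h2, Nat.add_mul_div_left _ _ h0, Nat.div_eq_of_lt hb, zero_add]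
  refine Prod.ext (Fin.ext ?_) (Fin.ext ?_)
  · simp only [pairAt, h3, Fin.val_ofNat, Nat.add_mul_mod_self_left]
    exact Nat.mod_eq_of_lt ha
  · simp only [pairAt, h2, Fin.val_ofNat, Nat.add_mul_mod_self_left]
    exact Nat.mod_eq_of_lt hb

theorem foldl_closeStep_mono {n : ℕ} [NeZero n] {G : SimpleGraph (Fin n)} (M L : Finset (Fin n)) :
    Monotone fun t => (pairs n t).foldl (closeStep G M) L := by
  refine monotone_nat_of_le_succ fun t => ?_
  rw [foldl_pairs_succ]
  exact subset_closeStep _ _ _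

/-- After `n` passes through all pairs, the closure is complete. -/
theorem closedIn_foldl_closeStep {n : ℕ} [NeZero n] {G : SimpleGraph (Fin n)}
    (M L : Finset (Fin n)) : ClosedIn G M ((pairs n (n * n * n)).foldl (closeStep G M) L) := by
  set f : ℕ → Finset (Fin n) := fun t => (pairs n t).foldl (closeStep G M) L with hf
  have hmono : Monotone f := foldl_closeStep_mono M L
  have hsucc : ∀ t, f (t + 1) = closeStep G M (f t) (pairAt n t) := fun t => foldl_pairs_succ _ _ _
  -- A pass that changes nothing certifies closedness, and any other pass gains a vertex; so after
  -- `n` passes the set is closed or contains all vertices.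
  have key : ∀ p, ClosedIn G M (f (p * (n * n))) ∨ p ≤ (f (p * (n * n))).card := by
    intro p
    induction p with
    | zero => right; omega
    | succ p ih =>
      have hle : p * (n * n) ≤ (p + 1) * (n * n) := Nat.mul_le_mul_right _ (by omega)
      by_cases heq : f ((p + 1) * (n * n)) = f (p * (n * n))
      · left
        intro a ha b hb hab
        obtain ⟨s, hs1, hs2, hs3⟩ := exists_pairAt p a b
        have h1 : a ∈ f s := hmono hs1 (heq ▸ ha)
        have h2 : b ∈ f (s + 1) := by
          rw [hsucc, hs3]
          exact mem_closeStep h1 hb hab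
        exact hmono hs2 h2
      · rcases ih with ih | ih
        · exfalso
          apply heq
          have : ∀ d, f (p * (n * n) + d) = f (p * (n * n)) := by
            intro d
            induction d with
            | zero => rfl
            | succ d ihd =>
              rw [← add_assoc, hsucc, ihd]
              exact (closeStep_subset subset_rfl ih _).antisymm (subset_closeStep _ _ _)
          have h := this (n * n)
          rwa [show p * (n * n) + n * n = (p + 1) * (n * n) by ring] at h
        · right
          have := Finset.card_lt_card ((hmono hle).lt_of_ne (Ne.symm heq))
          omega
  have h := key n
  rw [show n * (n * n) = n * n * n by ring] at h
  rcases h with h | h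
  · exact h
  · intro a _ b _ _
    have : f (n * n * n) = Finset.univ :=
      Finset.eq_univ_of_card _ (le_antisymm (Finset.card_le_univ _) (by simpa using h))
    rw [show (pairs n (n * n * n)).foldl (closeStep G M) L = f (n * n * n) from rfl, this]
    exact Finset.mem_univ _

/-! ### The dynamic programming table -/

section table

/-- The witness has mixed-radix digits `r`, `c`, `v`, `x`, so a single counter runs through all
rounds and, within each, all triples. -/
theorem decode_time {n : ℕ} {E r c : ℕ} (hc : c < E) (v x : Fin n) :
    ∃ τ, r * (n * n * E) ≤ τ ∧ τ < (r + 1) * (n * n * E) ∧ τ % n = x ∧ τ / n % n = v ∧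
      τ / (n * n) % E = c := by
  have hv := v.2
  have hx := x.2
  have h0 : 0 < n := by omega
  refine ⟨((r * E + c) * n + v) * n + x, ?_, ?_, ?_, ?_, ?_⟩
  · have : ((r * E + c) * n + v) * n + x = r * (n * n * E) + (c * n * n + v * n + x) := by ring
    omega
  · have h1 : (v : ℕ) * n + x < n * n := by nlinarith
    have h2 : (c + 1) * (n * n) ≤ E * (n * n) := Nat.mul_le_mul_right _ hc
    have : ((r * E + c) * n + v) * n + x = r * (n * n * E) + (c * (n * n) + (v * n + x)) := by ring
    rw [this, add_mul, one_mul, mul_comm (n * n) E]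
    linarith
  · rw [Nat.mul_add_mod_self_right, Nat.mod_eq_of_lt hx]
  · rw [Nat.add_div_of_dvd_right (Dvd.intro_left _ rfl), Nat.mul_div_cancel _ h0,
      Nat.div_eq_of_lt hx, add_zero, Nat.mul_add_mod_self_right, Nat.mod_eq_of_lt hv]
  · rw [← Nat.div_div_eq_div_mul, Nat.add_div_of_dvd_right (Dvd.intro_left _ rfl),
      Nat.mul_div_cancel _ h0, Nat.div_eq_of_lt hx, add_zero,
      Nat.add_div_of_dvd_right (Dvd.intro_left _ rfl), Nat.mul_div_cancel _ h0,
      Nat.div_eq_of_lt hv, add_zero, Nat.mul_add_mod_self_right, Nat.mod_eq_of_lt hc]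

variable {n : ℕ}

/-- Append the layer `A` to a layering of `L`. -/
noncomputable def tableUpdate (L A : Finset (Fin n)) (D : ℕ → ℕ) : ℕ → ℕ :=
  if D (mask L) ≠ 0 ∧ D (mask L + mask A) < D (mask L) + 1 then
    Function.update D (mask L + mask A) (D (mask L) + 1)
  else D

theorem le_tableUpdate (L A : Finset (Fin n)) (D : ℕ → ℕ) : D ≤ tableUpdate L A D := by
  intro z
  unfold tableUpdate
  split_ifs with h
  · rw [Function.update_apply]
    split_ifs with hz
    · rw [hz]
      exact h.2.le
    · exact le_rfl
  · exact le_rfl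

theorem succ_le_tableUpdate {L A : Finset (Fin n)} {D : ℕ → ℕ} (h : D (mask L) ≠ 0) :
    D (mask L) + 1 ≤ tableUpdate L A D (mask L + mask A) := by
  unfold tableUpdate
  split_ifs with h'
  · simp
  · by_contra hlt
    exact h' ⟨h, by omega⟩

/-- The vertices of `S` have a layering with `m` layers of which only the last one is joined to the
other vertices. -/
def HasLayering (G : SimpleGraph (Fin n)) (S : Finset (Fin n)) (m : ℕ) : Prop :=
  ∃ f : Fin n → ℕ, IsLayering G m f ∧ ∀ x, x ∈ S ↔ f x < m

variable {G : SimpleGraph (Fin n)}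

/-- Keep `f` on `L`, put `A` in layer `m` and everything else in layer `m + 1`. Closedness of `L`
excludes edges from `L` to the new remainder; edges from `L` to `A` were already legal because `A`
lay in the old remainder. -/
theorem HasLayering.append {L A : Finset (Fin n)} {m : ℕ} (h : HasLayering G L m)
    (hA : A.Nonempty) (hconn : ConnOn G (A : Set (Fin n))) (hdisj : Disjoint L A)
    (hclosed : ClosedIn G Aᶜ L) : HasLayering G (L ∪ A) (m + 1) := by
  obtain ⟨f, hf, hL⟩ := h
  have hm : ∀ x, x ∉ L → f x = m := fun x hx => by
    have := hf.le x
    have := mt (hL x).2 hx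
    omega
  have hAL : ∀ x ∈ A, x ∉ L := fun x hx hxL => Finset.disjoint_left.1 hdisj hxL hx
  let g : Fin n → ℕ := fun x => if x ∈ L then f x else if x ∈ A then m else m + 1
  have g1 : ∀ x ∈ L, g x = f x := fun x hx => by simp [g, hx]
  have g2 : ∀ x ∈ A, g x = m := fun x hx => by simp [g, hx, hAL x hx]
  have g3 : ∀ x, x ∉ L → x ∉ A → g x = m + 1 := fun x hx hx' => by simp [g, hx, hx']
  have glt : ∀ x, g x < m ↔ x ∈ L := by
    intro x
    by_cases h1 : x ∈ L
    · simpa [h1, g1 x h1] using (hL x).1 h1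
    · by_cases h2 : x ∈ A
      · simp [h1, g2 x h2]
      · simp [h1, g3 x h1 h2]
  have geq : ∀ x, g x = m ↔ x ∈ A := by
    intro x
    by_cases h1 : x ∈ L
    · have := (glt x).2 h1
      have h2 : x ∉ A := fun h => hAL x h h1
      simp [h2, this.ne]
    · by_cases h2 : x ∈ A
      · simp [h2, g2 x h2]
      · simp [h2, g3 x h1 h2]
  have gle : ∀ x, g x ≤ m + 1 := by
    intro x
    by_cases h1 : x ∈ L
    · have := (glt x).2 h1
      omega
    · by_cases h2 : x ∈ A
      · simp [g2 x h2]
      · simp [g3 x h1 h2]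
  refine ⟨g, ⟨gle, ?_, ?_, ?_⟩, ?_⟩
  · intro i hi
    rcases Nat.lt_succ_iff_lt_or_eq.1 hi with hi | rfl
    · obtain ⟨x, hx⟩ := hf.surj i hi
      exact ⟨x, by rw [g1 x ((hL x).2 (hx ▸ hi)), hx]⟩
    · obtain ⟨x, hx⟩ := hA
      exact ⟨x, g2 x hx⟩
  · intro a b hab
    by_cases ha : a ∈ L
    · have := (glt a).2 ha
      by_cases hb : b ∈ L
      · rw [g1 a ha, g1 b hb]
        exact hf.adj a b hab
      · have : ¬ g b < m := mt (glt b).1 hb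
        omega
    · by_cases hb : b ∈ L
      · have haA : a ∈ A := by
          by_contra h
          exact ha (hclosed b hb a (Finset.mem_compl.2 h) hab.symm)
        rw [g2 a haA, g1 b hb, ← hm a ha]
        exact hf.adj a b hab
      · have := gle a
        have : ¬ g b < m := mt (glt b).1 hb
        omega
  · intro i hi
    rcases Nat.lt_succ_iff_lt_or_eq.1 hi with hi | rfl
    · have : {x | g x = i} = {x | f x = i} := by
        ext x
        simp only [Set.mem_ofPred_eq]
        by_cases hx : x ∈ L
        · rw [g1 x hx]
        · have h1 : ¬ g x < m := mt (glt x).1 hx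
          have h2 := hm x hx
          constructor <;> intro <;> omega
      rw [this]
      exact hf.conn i hi
    · have : {x | g x = i} = (A : Set (Fin n)) := by
        ext x
        exact geq x
      rw [this]
      exact hconn
  · intro x
    rw [Finset.mem_union, Nat.lt_succ_iff_lt_or_eq, glt, geq]

/-- A layer together with its two neighbouring layers is small. -/
theorem IsLayering.card_near {m K : ℕ} {f : Fin n → ℕ} (hf : IsLayering G m f) (hn : n ≤ m + K)
    (i : ℕ) :
    (Finset.univ.filter fun x => f x = i ∨ f x = i + 1 ∨ f x + 1 = i).card ≤ K + 3 := by
  set U := Finset.univ.filter fun x => f x = i ∨ f x = i + 1 ∨ f x + 1 = i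
  -- All layers but the three in question are hit from outside `U`, whence m ≤ n - |U| + 3. The
  -- truncation of `i - 1` at zero is harmless, since only the count three matters.
  have h1 : Finset.range m ⊆ Uᶜ.image f ∪ {i, i + 1, i - 1} := by
    intro j hj
    obtain ⟨x, hx⟩ := hf.surj j (Finset.mem_range.1 hj)
    by_cases hxU : x ∈ U
    · have : f x = i ∨ f x = i + 1 ∨ f x + 1 = i := by simpa [U] using hxU
      refine Finset.mem_union_right _ ?_
      simp only [Finset.mem_insert, Finset.mem_singleton]
      omega
    · exact Finset.mem_union_left _ (Finset.mem_image.2 ⟨x, Finset.mem_compl.2 hxU, hx⟩)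
  have h2 := (Finset.card_le_card h1).trans (Finset.card_union_le _ _)
  have h3 : Uᶜ.card = n - U.card := by rw [Finset.card_compl, Fintype.card_fin]
  have h4 : (Uᶜ.image f).card ≤ Uᶜ.card := Finset.card_image_le
  have h5 : ({i, i + 1, i - 1} : Finset ℕ).card ≤ 3 := Finset.card_le_three
  have h6 : U.card ≤ n := by simpa using Finset.card_le_univ U
  rw [Finset.card_range] at h2
  omega

/-! ### Soundness and completeness of the table -/

variable [NeZero n] (G)

/-- The connected set tried at time `τ`. -/
noncomputable def bagAt (E τ : ℕ) : Finset (Fin n) :=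
  ((pairs n (n * n * n)).foldl (growStep G)
    ({Fin.ofNat n (τ / n)}, {Fin.ofNat n (τ / n)}, τ / (n * n) % E)).1

/-- The component outside `A` tried at time `τ`; it is empty if its starting vertex is in `A`. -/
noncomputable def sideAt (A : Finset (Fin n)) (τ : ℕ) : Finset (Fin n) :=
  (pairs n (n * n * n)).foldl (closeStep G Aᶜ) ({Fin.ofNat n τ} \ A)

/-- The table at time `τ`: the entry of a set of vertices is one more than the number of layers of
the best layering found, and zero if none has been found. -/
noncomputable def table (E : ℕ) : ℕ → ℕ → ℕ
  | 0 => Function.update 0 0 1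
  | τ + 1 => tableUpdate (sideAt G (bagAt G E τ) τ) (bagAt G E τ) (table E τ)

variable {G}

theorem bagAt_nonempty (E τ : ℕ) : (bagAt G E τ).Nonempty :=
  ⟨_, fst_subset_foldl_growStep _ _ (Finset.mem_singleton_self _)⟩

theorem bagAt_connOn (E τ : ℕ) : ConnOn G (bagAt G E τ : Set (Fin n)) := by
  refine foldl_growStep_connOn _ _ ?_
  rintro T - a ha b hb haT
  simp only [Finset.coe_singleton, Set.mem_singleton_iff] at ha hb
  rwa [hb, ← ha]

theorem sideAt_disjoint (A : Finset (Fin n)) (τ : ℕ) : Disjoint (sideAt G A τ) A := by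
  have : sideAt G A τ ⊆ Aᶜ := by
    refine foldl_closeStep_subset (fun a _ b hb _ => hb) _ _ ?_
    intro x hx
    rw [Finset.mem_compl]
    exact (Finset.mem_sdiff.1 hx).2
  exact Finset.disjoint_left.2 fun x hx => Finset.mem_compl.1 (this hx)

/-- Soundness for any `E` and `τ`: the tried set is connected, and the side is disjoint from it and
closed outside it, so every update is an instance of `HasLayering.append`. Connectedness of `G`
plays no role here. -/
theorem hasLayering_of_table (E τ : ℕ) : ∀ S : Finset (Fin n), table G E τ (mask S) ≠ 0 →
    HasLayering G S (table G E τ (mask S) - 1) := by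
  induction τ with
  | zero =>
    intro S hS
    have hS0 : mask S = 0 := by
      by_contra h
      simp [table, h] at hS
    have hS' : S = ∅ := mask_injective (hS0.trans (by simp [mask]))
    subst hS'
    refine ⟨fun _ => 0, ⟨fun x => Nat.zero_le _, ?_, fun _ _ _ => Nat.zero_le _, ?_⟩, ?_⟩ <;>
    simp [table, hS0]
  | succ τ ih =>
    intro S
    rw [table, tableUpdate]
    set A := bagAt G E τ
    set L := sideAt G A τ
    split_ifs with h
    · rw [← mask_union (sideAt_disjoint A τ), Function.update_apply]
      split_ifs with hS
      · intro _
        have hS' := mask_injective hS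
        subst hS'
        have := (ih L h.1).append (bagAt_nonempty E τ) (bagAt_connOn E τ) (sideAt_disjoint A τ)
          (closedIn_foldl_closeStep _ _)
        rwa [show table G E τ (mask L) - 1 + 1 = table G E τ (mask L) + 1 - 1 by
          have := h.1
          omega] at this
      · exact ih S
    · exact ih S

theorem table_mono (E : ℕ) : Monotone (table G E) :=
  monotone_nat_of_le_succ fun _ => le_tableUpdate _ _ _

/-- A crude bound, needed to keep the entries short. -/
theorem table_le (E τ z : ℕ) : table G E τ z ≤ τ + 1 := by
  induction τ generalizing z with
  | zero =>
    simp only [table, Function.update_apply, Pi.zero_apply]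
    split_ifs <;> omega
  | succ τ ih =>
    rw [table, tableUpdate]
    split_ifs
    · rw [Function.update_apply]
      have h1 := ih (mask (sideAt G (bagAt G E τ) τ))
      have h2 := ih z
      split_ifs <;> omega
    · have := ih z
      omega

/-- Each layer and the set of all previous layers are tried in every round. -/
theorem IsLayering.exists_time {m K : ℕ} {f : Fin n → ℕ} (hG : ConnOn G Set.univ)
    (hf : IsLayering G m f) (hn : n ≤ m + K) {i : ℕ} (hi : i < m) (r : ℕ) :
    ∃ τ, r * (n * n * 2 ^ (K + 2)) ≤ τ ∧ τ < (r + 1) * (n * n * 2 ^ (K + 2)) ∧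
      bagAt G (2 ^ (K + 2)) τ = Finset.univ.filter (fun x => f x = i) ∧
      sideAt G (Finset.univ.filter (fun x => f x = i)) τ = Finset.univ.filter (fun x => f x < i) := by
  set W := Finset.univ.filter (fun x => f x = i) with hW
  have memW : ∀ x, x ∈ W ↔ f x = i := by simp [hW]
  set U := Finset.univ.filter fun x => f x = i ∨ f x = i + 1 ∨ f x + 1 = i with hU
  have memU : ∀ x, x ∈ U ↔ f x = i ∨ f x = i + 1 ∨ f x + 1 = i := by simp [hU]
  obtain ⟨v, hv⟩ := hf.surj i hi
  -- The seed of the side is a vertex of the preceding layer. For `i = 0` it is `v` itself, which is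
  -- removed as an element of the layer, leaving the empty prefix.
  obtain ⟨x, hx⟩ : ∃ x, (i = 0 ∧ x = v) ∨ f x + 1 = i := by
    rcases i with _ | i
    · exact ⟨v, Or.inl ⟨rfl, rfl⟩⟩
    · obtain ⟨x, hx⟩ := hf.surj i (by omega)
      exact ⟨x, Or.inr (by omega)⟩
  obtain ⟨c, hc, hgrow⟩ := exists_foldl_growStep (G := G) (W := W) (U := U) (by
    intro a ha b hab
    have h1 := hf.adj a b hab
    have h2 := hf.adj b a hab.symm
    rw [memW] at ha
    rw [memU]
    omega) (pairs n (n * n * n)) {v} {v} (by simpa using (memW v).2 hv) (by simp)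
  have hcE : c < 2 ^ (K + 2) := by
    -- The start vertex is decided from the outset, which leaves K + 3 - 1 possible decisions.
    refine hc.trans_le (Nat.pow_le_pow_right (by norm_num) ?_)
    have h1 : U.card ≤ K + 3 := hf.card_near hn i
    have h2 : v ∈ U := (memU v).2 (Or.inl hv)
    rw [Finset.sdiff_singleton_eq_erase, Finset.card_erase_of_mem h2]
    omega
  obtain ⟨τ, h1, h2, h3, h4, h5⟩ := decode_time (r := r) hcE v x
  have hx' : Fin.ofNat n τ = x := Fin.ext h3
  have hv' : Fin.ofNat n (τ / n) = v := Fin.ext h4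
  refine ⟨τ, h1, h2, ?_, ?_⟩
  · rw [bagAt, hv', h5, hgrow]
    refine (foldl_closeStep_subset (T := W) (fun a _ b hb _ => hb) _ _
      (by simpa using (memW v).2 hv)).antisymm ?_
    intro y hy
    have hcl := closedIn_foldl_closeStep (G := G) W {v}
    exact hf.conn i hi {y | y ∈ (pairs n (n * n * n)).foldl (closeStep G W) {v}}
      (fun a _ b hb haT hab => hcl a haT b ((memW b).2 hb) hab) v hv y ((memW y).1 hy)
      (subset_foldl_closeStep _ _ _ (Finset.mem_singleton_self v))
  · rw [sideAt, hx']
    rcases hx with ⟨rfl, rfl⟩ | hx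
    · have h6 : {x} \ W = ∅ := by simpa using (memW x).2 hv
      have h7 : Finset.univ.filter (fun x => f x < 0) = ∅ := by simp
      rw [h6, h7]
      refine Finset.subset_empty.1 (foldl_closeStep_subset ?_ _ _ subset_rfl)
      intro a ha
      simp at ha
    · have hxW : x ∉ W := fun h => by
        have := (memW x).1 h
        omega
      rw [Finset.sdiff_eq_self_of_disjoint (by simpa using hxW)]
      refine (foldl_closeStep_subset ?_ _ _ ?_).antisymm ?_
      · intro a ha b hb hab
        have h6 := hf.adj b a hab.symm
        rw [Finset.mem_compl, memW] at hb
        simp only [Finset.mem_filter, Finset.mem_univ, true_and] at ha ⊢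
        omega
      · intro y hy
        rw [Finset.mem_singleton] at hy
        simp only [Finset.mem_filter, Finset.mem_univ, true_and, hy]
        omega
      · set C := (pairs n (n * n * n)).foldl (closeStep G Wᶜ) {x} with hC
        have hcl : ClosedIn G Wᶜ C := closedIn_foldl_closeStep (G := G) Wᶜ {x}
        have hxC : x ∈ C := subset_foldl_closeStep _ _ _ (Finset.mem_singleton_self x)
        have hlayer : ∀ a ∈ C, f a < i → ∀ b, f b = f a → b ∈ C := by
          intro a ha hai b hb
          refine hf.conn (f a) (by omega) {y | y ∈ C} ?_ a rfl b hb ha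
          intro c _ d (hd : f d = f a) hcT hcd
          refine hcl c hcT d ?_ hcd
          rw [Finset.mem_compl, memW]
          omega
        -- Descend from layer `i - 1`: an edge between consecutive layers carries the closure one
        -- layer down, and connectedness spreads it over that layer.
        have hdown : ∀ d y, f y + 1 + d = i → y ∈ C := by
          intro d
          induction d with
          | zero => exact fun y hy => hlayer x hxC (by omega) y (by omega)
          | succ d ih =>
            intro y hy
            obtain ⟨z, hz⟩ := hf.surj (f y + 1) (by omega)
            obtain ⟨a, b, hab, ha, hb⟩ := hf.exists_adj hG (i := f y) (by omega) hz
            have hbC := ih b (by omega)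
            have haC := hcl b hbC a (by rw [Finset.mem_compl, memW]; omega) hab.symm
            exact hlayer a haC (by omega) y ha.symm
        intro y hy
        have hy' : f y < i := by simpa using hy
        exact hdown (i - f y - 1) y (by omega)

/-- When round `i` tries layer `i`, the entry of its prefix is already at least `i + 1`. Only lower
bounds are propagated, as a better layering of the same prefix may have been stored. -/
theorem le_table_of_isLayering {m K : ℕ} {f : Fin n → ℕ} (hG : ConnOn G Set.univ)
    (hf : IsLayering G m f) (hn : n ≤ m + K) : ∀ i ≤ m,
    i + 1 ≤ table G (2 ^ (K + 2)) (i * (n * n * 2 ^ (K + 2)))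
      (mask (Finset.univ.filter fun x => f x < i)) := by
  intro i
  induction i with
  | zero =>
    intro _
    have : mask (∅ : Finset (Fin n)) = 0 := by simp [mask]
    simp [table, this]
  | succ i ih =>
    intro hi
    obtain ⟨τ, h1, h2, h3, h4⟩ := hf.exists_time hG hn (i := i) (by omega) i
    have h5 := (ih (by omega)).trans (table_mono (G := G) _ h1 _)
    have h6 := table_mono (G := G) (2 ^ (K + 2)) (Nat.succ_le_of_lt h2)
      (mask (Finset.univ.filter fun x => f x < i + 1))
    have h7 : Finset.univ.filter (fun x => f x < i + 1) =
        Finset.univ.filter (fun x => f x < i) ∪ Finset.univ.filter (fun x => f x = i) := by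
      ext x
      simp only [Finset.mem_union, Finset.mem_filter, Finset.mem_univ, true_and]
      omega
    refine le_trans ?_ h6
    rw [h7, mask_union (by
      rw [Finset.disjoint_left]
      intro x hx hx'
      simp only [Finset.mem_filter, Finset.mem_univ, true_and] at hx hx'
      omega), Nat.succ_eq_add_one, table, h3, h4]
    exact le_trans (by omega) (succ_le_tableUpdate (by omega))

/-- The final entry of the table for the set of all vertices decides the problem. -/
theorem table_univ (hG : G.Connected) (k : ℕ) :
    table G (2 ^ (min k n + 2)) (n * n * n * 2 ^ (min k n + 2)) (2 ^ n - 1) + min k n - n ≠ 0 ↔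
      ContractibleToPath k G := by
  rw [contractibleToPath_iff hG, Nat.card_fin, ← mask_univ]
  have hn : 0 < n := Nat.pos_of_ne_zero (NeZero.ne n)
  -- A nonzero entry is the number of layers plus one, so the truncated difference is positive
  -- exactly when n ≤ layers + min k n; a zero entry gives zero because min k n ≤ n.
  constructor
  · intro h
    have h0 : table G (2 ^ (min k n + 2)) (n * n * n * 2 ^ (min k n + 2))
        (mask (Finset.univ : Finset (Fin n))) ≠ 0 := by omega
    obtain ⟨f, hf, hlt⟩ := hasLayering_of_table _ _ _ h0
    exact ⟨_, ⟨f, hf, fun x => (hlt x).1 (Finset.mem_univ x)⟩, by omega⟩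
  · rintro ⟨m, ⟨f, hf, hlt⟩, hc⟩
    -- Replacing `k` by the minimum loses nothing: for k ≥ n the inequality n ≤ m + n always holds.
    have h1 := le_table_of_isLayering (connOn_univ hG) hf (K := min k n) (by omega) m le_rfl
    have hm : m ≤ n := by
      have : Function.Surjective fun x : Fin n => (⟨f x, hlt x⟩ : Fin m) := fun i => by
        obtain ⟨x, hx⟩ := hf.surj i i.2
        exact ⟨x, Fin.ext hx⟩
      simpa using Fintype.card_le_of_surjective _ this
    have h2 : m * (n * n * 2 ^ (min k n + 2)) ≤ n * n * n * 2 ^ (min k n + 2) := by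
      rw [show n * n * n * 2 ^ (min k n + 2) = n * (n * n * 2 ^ (min k n + 2)) by ring]
      exact Nat.mul_le_mul_right _ hm
    have h3 := h1.trans (table_mono (G := G) _ h2 _)
    rw [Finset.filter_true_of_mem (fun x _ => hlt x)] at h3
    have hpos : 0 < m := by
      have := hlt ⟨0, hn⟩
      omega
    omega

end table

/-! ### The program -/

/-- The invariant restores the bound `b` after each iteration, so the growth of lengths inside the
body does not compound. -/
theorem halts_loop_of_loopFree {p : Cmd} (hp : p.LoopFree) (e : AExp) : ∃ K : ℕ,
    ∀ (N b : ℕ) (I : ℕ → Store → Prop), 1 ≤ N → 1 ≤ b →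
      (∀ i s, I i s → i ≤ N → s.Bounded b) →
      (∀ i s, I i s → i ≤ N → (e.val s ≠ 0 ↔ i < N)) →
      (∀ i s, i < N → I i s → I (i + 1) (p.run s)) →
      ∀ s, I 0 s → Halts (.loop e p) s (K * N * b) (I N) := by
  obtain ⟨K, hK⟩ := hp.halts
  obtain ⟨C, hC⟩ := e.exists_bound
  refine ⟨K + 2 * C + 2, fun N b I hN hb hB hguard hrun s hs => ?_⟩
  refine (halts_loop I (T := K * b) (C := C * b) hguard
    (fun i s h hi => (hC s b hb (hB i s h hi)).2)
    (fun i s hi h => (hK s b hb (hB i s h hi.le)).mono le_rfl ?_) hs).mono ?_ fun _ h => h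
  · rintro s' rfl
    exact hrun i s hi h
  · have h1 : 1 * b ≤ N * b := Nat.mul_le_mul_right b hN
    have h2 : C * (1 * b) ≤ C * (N * b) := Nat.mul_le_mul_left C h1
    have h3 : N * 1 ≤ N * b := Nat.mul_le_mul_left N hb
    have h4 : (K + 2 * C + 2) * N * b = K * (N * b) + C * (N * b) + C * (N * b) + N * b + N * b := by
      ring
    have h5 : N * (K * b + C * b + 1) = K * (N * b) + C * (N * b) + N := by ring
    rw [h4, h5]
    linarith

/-- The stores that occur during the computation. -/
def st (n k E τ t c A F L : ℕ) (M P D : ℕ → ℕ) : Store where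
  reg x := match x with
    | 0 => n | 1 => k | 2 => E | 3 => τ | 4 => t | 5 => c | 6 => A | 7 => F | 8 => L | _ => 0
  arr a := match a with
    | 0 => M | 1 => P | 2 => D | _ => fun _ => 0

section

variable (n k E τ t c A F L v i : ℕ) (M P D : ℕ → ℕ)

theorem st_reg :
    (st n k E τ t c A F L M P D).reg 0 = n ∧ (st n k E τ t c A F L M P D).reg 1 = k ∧
    (st n k E τ t c A F L M P D).reg 2 = E ∧ (st n k E τ t c A F L M P D).reg 3 = τ ∧
    (st n k E τ t c A F L M P D).reg 4 = t ∧ (st n k E τ t c A F L M P D).reg 5 = c ∧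
    (st n k E τ t c A F L M P D).reg 6 = A ∧ (st n k E τ t c A F L M P D).reg 7 = F ∧
    (st n k E τ t c A F L M P D).reg 8 = L :=
  ⟨rfl, rfl, rfl, rfl, rfl, rfl, rfl, rfl, rfl⟩

theorem st_arr :
    (st n k E τ t c A F L M P D).arr 0 = M ∧ (st n k E τ t c A F L M P D).arr 1 = P ∧
    (st n k E τ t c A F L M P D).arr 2 = D := ⟨rfl, rfl, rfl⟩

theorem setReg_eq {s s' : Store} {x v : ℕ} (harr : s'.arr = s.arr) (hx : s'.reg x = v)
    (hreg : ∀ y, y ≠ x → s'.reg y = s.reg y) : s.setReg x v = s' := by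
  obtain ⟨r', a'⟩ := s'
  obtain rfl : a' = s.arr := harr
  have : Function.update s.reg x v = r' := by
    funext y
    by_cases hy : y = x
    · subst hy
      simp [← hx]
    · rw [Function.update_of_ne hy]
      exact (hreg y hy).symm
  simp [Store.setReg, this]

theorem st_setReg :
    (st n k E τ t c A F L M P D).setReg 0 v = st v k E τ t c A F L M P D ∧
    (st n k E τ t c A F L M P D).setReg 1 v = st n v E τ t c A F L M P D ∧
    (st n k E τ t c A F L M P D).setReg 2 v = st n k v τ t c A F L M P D ∧
    (st n k E τ t c A F L M P D).setReg 3 v = st n k E v t c A F L M P D ∧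
    (st n k E τ t c A F L M P D).setReg 4 v = st n k E τ v c A F L M P D ∧
    (st n k E τ t c A F L M P D).setReg 5 v = st n k E τ t v A F L M P D ∧
    (st n k E τ t c A F L M P D).setReg 6 v = st n k E τ t c v F L M P D ∧
    (st n k E τ t c A F L M P D).setReg 7 v = st n k E τ t c A v L M P D ∧
    (st n k E τ t c A F L M P D).setReg 8 v = st n k E τ t c A F v M P D := by
  refine ⟨?_, ?_, ?_, ?_, ?_, ?_, ?_, ?_, ?_⟩ <;>
  · refine setReg_eq rfl rfl fun y hy => ?_
    rcases y with _ | _ | _ | _ | _ | _ | _ | _ | _ | y <;> first | rfl | exact absurd rfl hy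

theorem setArr_eq {s s' : Store} {a i v : ℕ} (hreg : s'.reg = s.reg)
    (hx : s'.arr a = Function.update (s.arr a) i v)
    (harr : ∀ y, y ≠ a → s'.arr y = s.arr y) : s.setArr a i v = s' := by
  obtain ⟨r', a'⟩ := s'
  obtain rfl : r' = s.reg := hreg
  have : Function.update s.arr a (Function.update (s.arr a) i v) = a' := by
    funext y
    by_cases hy : y = a
    · subst hy
      simp [← hx]
    · rw [Function.update_of_ne hy]
      exact (harr y hy).symm
  simp [Store.setArr, this]

theorem st_setArr :
    (st n k E τ t c A F L M P D).setArr 1 i v =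
      st n k E τ t c A F L M (Function.update P i v) D ∧
    (st n k E τ t c A F L M P D).setArr 2 i v =
      st n k E τ t c A F L M P (Function.update D i v) := by
  refine ⟨?_, ?_⟩ <;>
  · refine setArr_eq rfl rfl fun y hy => ?_
    rcases y with _ | _ | _ | y <;> first | rfl | exact absurd rfl hy

theorem bounded_st {b : ℕ} (h : ∀ x ∈ [n, k, E, τ, t, c, A, F, L], x < 2 ^ b)
    (hM : ∀ z, M z < 2 ^ b) (hP : ∀ z, P z < 2 ^ b) (hD : ∀ z, D z < 2 ^ b) :
    (st n k E τ t c A F L M P D).Bounded b := by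
  simp only [List.forall_mem_cons] at h
  refine ⟨fun x => ?_, fun a z => ?_⟩
  · rw [Nat.size_le]
    rcases x with _ | _ | _ | _ | _ | _ | _ | _ | _ | x
    · exact h.1
    · exact h.2.1
    · exact h.2.2.1
    · exact h.2.2.2.1
    · exact h.2.2.2.2.1
    · exact h.2.2.2.2.2.1
    · exact h.2.2.2.2.2.2.1
    · exact h.2.2.2.2.2.2.2.1
    · exact h.2.2.2.2.2.2.2.2.1
    · exact Nat.two_pow_pos b
  · rw [Nat.size_le]
    rcases a with _ | _ | _ | a
    · exact hM z
    · exact hP z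
    · exact hD z
    · exact Nat.two_pow_pos b

end

/-- The remainder of a division. -/
def AExp.mod (a b : AExp) : AExp := .op .sub a (.op .mul (.op .div a b) b)

/-- The digit `j` of `S`, where the powers of two are read from array 1. -/
def AExp.bit (S j : AExp) : AExp := .mod (.op .div S (.load 1 j)) (.lit 2)

theorem AExp.val_mod (a b : AExp) (s : Store) : (AExp.mod a b).val s = a.val s % b.val s := by
  simp only [AExp.mod, AExp.val, Op.apply]
  rw [mul_comm, ← Nat.mod_eq_sub]

theorem AExp.val_bit (S j : AExp) (s : Store) :
    (AExp.bit S j).val s = S.val s / s.arr 1 (j.val s) % 2 := by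
  simp only [AExp.bit, AExp.val_mod, AExp.val, Op.apply]

/-- The second vertex of the pair treated at the time in register 4. -/
def sndExp : AExp := .mod (.reg 4) (.reg 0)

/-- The first vertex of the pair treated at the time in register 4. -/
def fstExp : AExp := .mod (.op .div (.reg 4) (.reg 0)) (.reg 0)

/-- The entry of the adjacency matrix for the pair treated at the time in register 4. -/
def adjExp : AExp := .load 0 (.mod (.reg 4) (.op .mul (.reg 0) (.reg 0)))

/-- The cube of the number of vertices. -/
def cubeExp : AExp := .op .mul (.op .mul (.reg 0) (.reg 0)) (.reg 0)

/-- The program for `growStep`. -/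
def growCmd : Cmd :=
  .seq
    (.branch (.op .mul (.op .mul (.bit (.reg 6) fstExp) adjExp)
        (.op .sub (.lit 1) (.bit (.reg 7) sndExp)))
      (.seq (.assign 6 (.op .add (.reg 6) (.op .mul (.mod (.reg 5) (.lit 2)) (.load 1 sndExp))))
        (.seq (.assign 7 (.op .add (.reg 7) (.load 1 sndExp)))
          (.assign 5 (.op .div (.reg 5) (.lit 2)))))
      .skip)
    (.assign 4 (.op .add (.reg 4) (.lit 1)))

/-- The program for `closeStep`. -/
def closeCmd : Cmd :=
  .seq
    (.branch (.op .mul (.op .mul (.op .mul (.bit (.reg 8) fstExp) adjExp)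
        (.op .sub (.lit 1) (.bit (.reg 8) sndExp))) (.op .sub (.lit 1) (.bit (.reg 6) sndExp)))
      (.assign 8 (.op .add (.reg 8) (.load 1 sndExp)))
      .skip)
    (.assign 4 (.op .add (.reg 4) (.lit 1)))

/-- The program that prepares the enumeration of connected sets at the time in register 3. -/
def growInit : Cmd :=
  .seq (.assign 5 (.mod (.op .div (.reg 3) (.op .mul (.reg 0) (.reg 0))) (.reg 2)))
    (.seq (.assign 6 (.load 1 (.mod (.op .div (.reg 3) (.reg 0)) (.reg 0))))
      (.seq (.assign 7 (.reg 6)) (.assign 4 (.lit 0))))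

/-- The program that prepares the closure at the time in register 3. -/
def closeInit : Cmd :=
  .seq (.assign 8 (.op .mul (.load 1 (.mod (.reg 3) (.reg 0)))
      (.op .sub (.lit 1) (.bit (.reg 6) (.mod (.reg 3) (.reg 0))))))
    (.assign 4 (.lit 0))

/-- The program for `tableUpdate`. -/
def updateCmd : Cmd :=
  .seq
    (.branch (.op .mul (.load 2 (.reg 8)) (.op .sub (.op .add (.load 2 (.reg 8)) (.lit 1))
        (.load 2 (.op .add (.reg 8) (.reg 6)))))
      (.store 2 (.op .add (.reg 8) (.reg 6)) (.op .add (.load 2 (.reg 8)) (.lit 1)))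
      .skip)
    (.assign 3 (.op .add (.reg 3) (.lit 1)))

/-- The guard of the inner loops. -/
def innerGuard : AExp := .op .sub cubeExp (.reg 4)

/-- One step of the computation of the table. -/
def tableCmd : Cmd :=
  .seq growInit (.seq (.loop innerGuard growCmd) (.seq closeInit
    (.seq (.loop innerGuard closeCmd) updateCmd)))

/-- Replace `k` by the minimum of `k` and `n`; initialise the powers of two and the table. -/
def initCmd : Cmd :=
  .seq (.branch (.op .sub (.reg 1) (.reg 0)) (.assign 1 (.reg 0)) .skip)
    (.seq (.store 1 (.lit 0) (.lit 1)) (.store 2 (.lit 0) (.lit 1)))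

/-- Compute the next power of two. -/
def powCmd : Cmd :=
  .seq (.store 1 (.op .add (.reg 4) (.lit 1)) (.op .mul (.load 1 (.reg 4)) (.lit 2)))
    (.assign 4 (.op .add (.reg 4) (.lit 1)))

/-- The guard of the loop computing the powers of two. -/
def powGuard : AExp := .op .sub (.op .add (.reg 0) (.lit 2)) (.reg 4)

/-- The number of decision sequences. -/
def rangeCmd : Cmd := .assign 2 (.load 1 (.op .add (.reg 1) (.lit 2)))

/-- The guard of the outer loop. -/
def outerGuard : AExp := .op .sub (.op .mul cubeExp (.reg 2)) (.reg 3)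

/-- Evaluate the table. -/
def answerCmd : Cmd :=
  .branch (.op .sub (.op .add (.load 2 (.op .sub (.load 1 (.reg 0)) (.lit 1))) (.reg 1)) (.reg 0))
    (.assign 0 (.lit 1)) (.assign 0 (.lit 0))

/-- The algorithm for Path Contraction. -/
def pathContraction : Cmd :=
  .seq initCmd (.seq (.loop powGuard powCmd) (.seq rangeCmd
    (.seq (.loop outerGuard tableCmd) answerCmd)))

/-! ### Contents of the arrays and effect of the loop-free commands -/

/-- The powers of two up to the exponent `m`. -/
def powTable (m : ℕ) (i : ℕ) : ℕ := if i ≤ m then 2 ^ i else 0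

theorem powTable_apply {m i : ℕ} (h : i ≤ m) : powTable m i = 2 ^ i := if_pos h

/-- The adjacency matrix as it is stored in array 0. -/
noncomputable def adjTable {n : ℕ} (G : SimpleGraph (Fin n)) : ℕ → ℕ := (inputStore G 0).arr 0

open Classical in
theorem adjTable_apply {n : ℕ} (G : SimpleGraph (Fin n)) (i j : Fin n) :
    adjTable G (i * n + j) = if G.Adj i j then 1 else 0 := by
  have h0 : 0 < n := i.pos
  simp only [adjTable, inputStore, true_and]
  refine if_congr ⟨?_, fun h => ⟨i, j, h, rfl⟩⟩ rfl rfl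
  rintro ⟨i', j', hadj, h⟩
  have hj : (j : ℕ) = j' := by
    have := congrArg (· % n) h
    simpa [Nat.mul_add_mod_self_right, Nat.mod_eq_of_lt j.2, Nat.mod_eq_of_lt j'.2] using this
  have hi : (i : ℕ) = i' := by
    rw [hj] at h
    exact Nat.eq_of_mul_eq_mul_right h0 (Nat.add_right_cancel h)
  rwa [Fin.ext hi, Fin.ext hj]

theorem adjTable_le {n : ℕ} (G : SimpleGraph (Fin n)) (z : ℕ) : adjTable G z ≤ 1 := by
  simp only [adjTable, inputStore]
  split_ifs <;> omega

section run

variable {n : ℕ} {G : SimpleGraph (Fin n)} {k E τ t c : ℕ} {D : ℕ → ℕ}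

theorem run_updateCmd (A L : Finset (Fin n)) (F : ℕ) (M P : ℕ → ℕ) :
    updateCmd.run (st n k E τ t c (mask A) F (mask L) M P D) =
      st n k E (τ + 1) t c (mask A) F (mask L) M P (tableUpdate L A D) := by
  simp only [updateCmd, Cmd.run, AExp.val, Op.apply, st_reg, st_arr, st_setArr, tableUpdate]
  by_cases h : D (mask L) ≠ 0 ∧ D (mask L + mask A) < D (mask L) + 1
  · rw [if_pos h, if_pos (Nat.mul_ne_zero h.1 (by omega))]
    simp only [st_reg, st_setReg]
  · rw [if_neg h, if_neg]
    · simp only [st_reg, st_setReg]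
    · intro h'
      rw [ne_eq, mul_eq_zero, not_or] at h'
      exact h ⟨h'.1, by omega⟩

theorem run_powCmd {A F L : ℕ} {M : ℕ → ℕ} :
    powCmd.run (st n k E τ t c A F L M (powTable t) D) =
      st n k E τ (t + 1) c A F L M (powTable (t + 1)) D := by
  simp only [powCmd, Cmd.run, AExp.val, Op.apply, st_reg, st_arr, st_setArr, st_setReg]
  congr 1
  funext i
  simp only [Function.update_apply, powTable, le_refl, if_true]
  split_ifs with h1 h2 h3 <;> first | omega | rfl | skip
  rw [h1, pow_succ]

variable [NeZero n]

open Classical in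
-- Reducing modulo n² leaves the two lowest base-n digits of `t`, which are the row and the column
-- of the current pair.
theorem adj_val (t : ℕ) : adjTable G (t % (n * n)) =
    if G.Adj (Fin.ofNat n (t / n)) (Fin.ofNat n t) then 1 else 0 := by
  rw [← adjTable_apply, Nat.mod_mul]
  congr 1
  simp only [Fin.val_ofNat]
  ring

theorem pow_val (t : ℕ) : powTable (n + 2) (t % n) = 2 ^ ((Fin.ofNat n t : Fin n) : ℕ) := by
  have hn : 0 < n := Nat.pos_of_ne_zero (NeZero.ne n)
  have := Nat.mod_lt t hn
  rw [powTable_apply (by omega)]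
  rfl

/-- The guard tests membership in `F` only; `hAF` ensures that adding the power of two to the mask
of `A` really is an insertion. -/
theorem run_growCmd {A F : Finset (Fin n)} (hAF : A ⊆ F) (L : ℕ) :
    growCmd.run (st n k E τ t c (mask A) (mask F) L (adjTable G) (powTable (n + 2)) D) =
      st n k E τ (t + 1) (growStep G (A, F, c) (pairAt n t)).2.2
        (mask (growStep G (A, F, c) (pairAt n t)).1)
        (mask (growStep G (A, F, c) (pairAt n t)).2.1) L (adjTable G) (powTable (n + 2)) D := by
  classical
  have hg : growStep G (A, F, c) (pairAt n t) = if Fin.ofNat n (t / n) ∈ A ∧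
      G.Adj (Fin.ofNat n (t / n)) (Fin.ofNat n t) ∧ Fin.ofNat n t ∉ F then
        (if c % 2 = 1 then insert (Fin.ofNat n t) A else A, insert (Fin.ofNat n t) F, c / 2)
      else (A, F, c) := if_congr Iff.rfl rfl rfl
  simp only [hg, growCmd, Cmd.run, AExp.val, AExp.val_bit, AExp.val_mod, fstExp, sndExp, adjExp,
    Op.apply, st_reg, st_arr, adj_val, pow_val, mask_div_mod]
  by_cases h : Fin.ofNat n (t / n) ∈ A ∧ G.Adj (Fin.ofNat n (t / n)) (Fin.ofNat n t) ∧
      Fin.ofNat n t ∉ F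
  · have hA : Fin.ofNat n t ∉ A := fun h' => h.2.2 (hAF h')
    rw [if_pos h, if_pos (by rw [if_pos h.1, if_pos h.2.1, if_neg h.2.2]; norm_num)]
    simp only [st_setReg, st_reg, st_arr, pow_val, mask_insert h.2.2]
    split_ifs with hc
    · rw [hc, one_mul, mask_insert hA]
    · rw [show c % 2 = 0 by omega, zero_mul, add_zero]
  · rw [if_neg h, if_neg]
    · simp only [st_setReg, st_reg]
    · intro h'
      apply h
      refine ⟨?_, ?_, ?_⟩
      · by_contra h1
        apply h'
        rw [if_neg h1]
        simp
      · by_contra h1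
        apply h'
        rw [if_neg h1]
        simp
      · intro h1
        apply h'
        rw [if_pos h1]
        simp

theorem run_closeCmd {A L : Finset (Fin n)} (F : ℕ) :
    closeCmd.run (st n k E τ t c (mask A) F (mask L) (adjTable G) (powTable (n + 2)) D) =
      st n k E τ (t + 1) c (mask A) F (mask (closeStep G Aᶜ L (pairAt n t)))
        (adjTable G) (powTable (n + 2)) D := by
  classical
  have hg : closeStep G Aᶜ L (pairAt n t) = if Fin.ofNat n (t / n) ∈ L ∧
      G.Adj (Fin.ofNat n (t / n)) (Fin.ofNat n t) ∧ Fin.ofNat n t ∉ L ∧ Fin.ofNat n t ∉ A then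
        insert (Fin.ofNat n t) L
      else L := if_congr (and_congr Iff.rfl (and_congr Iff.rfl (and_congr Iff.rfl
        Finset.mem_compl))) rfl rfl
  simp only [hg, closeCmd, Cmd.run, AExp.val, AExp.val_bit, AExp.val_mod, fstExp, sndExp, adjExp,
    Op.apply, st_reg, st_arr, adj_val, pow_val, mask_div_mod]
  by_cases h : Fin.ofNat n (t / n) ∈ L ∧ G.Adj (Fin.ofNat n (t / n)) (Fin.ofNat n t) ∧
      Fin.ofNat n t ∉ L ∧ Fin.ofNat n t ∉ A
  · rw [if_pos h, if_pos (by
      rw [if_pos h.1, if_pos h.2.1, if_neg h.2.2.1, if_neg h.2.2.2]; norm_num)]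
    simp only [st_setReg, st_reg, mask_insert h.2.2.1]
  · rw [if_neg h, if_neg]
    · simp only [st_setReg, st_reg]
    · intro h'
      apply h
      refine ⟨?_, ?_, ?_, ?_⟩
      · by_contra h1
        apply h'
        rw [if_neg h1]
        simp
      · by_contra h1
        apply h'
        rw [if_neg h1]
        simp
      · intro h1
        apply h'
        rw [if_pos h1]
        simp
      · intro h1
        apply h'
        rw [if_pos h1]
        simp

theorem run_growInit (A F L : ℕ) :
    growInit.run (st n k E τ t c A F L (adjTable G) (powTable (n + 2)) D) =
      st n k E τ 0 (τ / (n * n) % E) (mask {Fin.ofNat n (τ / n)}) (mask {Fin.ofNat n (τ / n)}) L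
        (adjTable G) (powTable (n + 2)) D := by
  simp only [growInit, Cmd.run, AExp.val, AExp.val_mod, Op.apply, st_reg, st_arr, st_setReg,
    pow_val, mask_singleton]

theorem run_closeInit (A : Finset (Fin n)) (F L : ℕ) :
    closeInit.run (st n k E τ t c (mask A) F L (adjTable G) (powTable (n + 2)) D) =
      st n k E τ 0 c (mask A) F (mask ({Fin.ofNat n τ} \ A)) (adjTable G) (powTable (n + 2)) D := by
  simp only [closeInit, Cmd.run, AExp.val, AExp.val_mod, AExp.val_bit, Op.apply, st_reg, st_arr,
    st_setReg, mask_div_mod, pow_val]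
  congr 1
  by_cases h : Fin.ofNat n τ ∈ A
  · rw [if_pos h, Finset.sdiff_eq_empty_iff_subset.2 (by simpa using h)]
    simp [mask]
  · rw [if_neg h, Finset.sdiff_eq_self_of_disjoint (by simpa using h), mask_singleton]
    simp

/-- The table at time zero does not depend on `E`, which the program computes only later; hence `E`
is free here. -/
theorem run_initCmd : initCmd.run (inputStore G k) =
    st n (min k n) 0 0 0 0 0 0 0 (adjTable G) (powTable 0) (table G E 0) := by
  have h : inputStore G k = st n k 0 0 0 0 0 0 0 (adjTable G) 0 0 := by
    have hr : (inputStore G k).reg = (st n k 0 0 0 0 0 0 0 (adjTable G) 0 0).reg := by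
      funext x
      rcases x with _ | _ | _ | _ | _ | _ | _ | _ | _ | x <;> rfl
    have ha : (inputStore G k).arr = (st n k 0 0 0 0 0 0 0 (adjTable G) 0 0).arr := by
      funext a
      rcases a with _ | _ | _ | a
      · rfl
      all_goals
        funext m
        simp [inputStore, st]
    calc inputStore G k = ⟨(inputStore G k).reg, (inputStore G k).arr⟩ := rfl
      _ = _ := by rw [hr, ha]
  have hP : Function.update (0 : ℕ → ℕ) 0 1 = powTable 0 := by
    funext i
    rcases i with _ | i <;> simp [powTable]
  rw [h]
  simp only [initCmd, Cmd.run, AExp.val, Op.apply, st_reg]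
  split_ifs with hk
  · simp only [st_setReg, st_setArr, hP, table]
    rw [min_eq_right (by omega)]
  · simp only [st_setArr, hP, table]
    rw [min_eq_left (by omega)]

end run

/-! ### Running time -/

theorem two_pow_le_of_le {n a : ℕ} (h : a ≤ 10 * n) : 2 ^ a ≤ 2 ^ (10 * n) :=
  Nat.pow_le_pow_right (by norm_num) h

theorem cube_lt (n : ℕ) : n * n * n < 2 ^ (3 * n) := by
  have h : n < 2 ^ n := Nat.lt_two_pow_self
  have h1 : 2 ^ (3 * n) = 2 ^ n * 2 ^ n * 2 ^ n := by ring
  rw [h1]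
  exact Nat.mul_lt_mul'' (Nat.mul_lt_mul'' h h) h

theorem mask_lt_ten {n : ℕ} (S : Finset (Fin n)) : mask S < 2 ^ (10 * n) :=
  (mask_lt S).trans_le (two_pow_le_of_le (by omega))

section halts

variable {n : ℕ} [NeZero n] {G : SimpleGraph (Fin n)}

theorem one_le_n : 1 ≤ n := Nat.pos_of_ne_zero (NeZero.ne n)

theorem powTable_lt {m : ℕ} (hm : m ≤ n + 2) (z : ℕ) : powTable m z < 2 ^ (10 * n) := by
  have hn := one_le_n (n := n)
  unfold powTable
  split_ifs with h
  · exact Nat.pow_lt_pow_right (by norm_num) (by omega)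
  · exact Nat.two_pow_pos _

theorem adjTable_lt (z : ℕ) : adjTable G z < 2 ^ (10 * n) := by
  have hn := one_le_n (n := n)
  have h1 := adjTable_le G z
  have h2 : 2 ^ 1 ≤ 2 ^ (10 * n) := two_pow_le_of_le (by omega)
  omega

theorem foldl_growStep_subset (s : Finset (Fin n) × Finset (Fin n) × ℕ) (hs : s.1 ⊆ s.2.1)
    (t : ℕ) : ((pairs n t).foldl (growStep G) s).1 ⊆ ((pairs n t).foldl (growStep G) s).2.1 := by
  induction t with
  | zero => exact hs
  | succ t ih =>
    rw [foldl_pairs_succ]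
    exact growStep_subset ih _

theorem foldl_growStep_snd_snd_le (s : Finset (Fin n) × Finset (Fin n) × ℕ) (t : ℕ) :
    ((pairs n t).foldl (growStep G) s).2.2 ≤ s.2.2 := by
  induction t with
  | zero => exact le_rfl
  | succ t ih =>
    rw [foldl_pairs_succ]
    exact (growStep_snd_snd_le _ _).trans ih

end halts

theorem val_innerGuard (n k E τ t c A F L : ℕ) (M P D : ℕ → ℕ) :
    innerGuard.val (st n k E τ t c A F L M P D) ≠ 0 ↔ t < n * n * n := by
  simp only [innerGuard, cubeExp, AExp.val, Op.apply, st_reg]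
  omega

/-- Only the grown set matters afterwards. The final clock, code and decided set are kept
existential, with size bounds, because they are overwritten before being read again. -/
theorem halts_growLoop : ∃ K : ℕ, ∀ (n : ℕ) [NeZero n] (G : SimpleGraph (Fin n))
    (k E τ c L : ℕ) (D : ℕ → ℕ) (v : Fin n), n < 2 ^ (10 * n) → k < 2 ^ (10 * n) →
    E < 2 ^ (10 * n) → τ < 2 ^ (10 * n) → c < 2 ^ (10 * n) → L < 2 ^ (10 * n) →
    (∀ z, D z < 2 ^ (10 * n)) →
    Halts (.loop innerGuard growCmd)
      (st n k E τ 0 c (mask {v}) (mask {v}) L (adjTable G) (powTable (n + 2)) D)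
      (K * (n * n * n) * (10 * n))
      (fun s => ∃ t c' F', t < 2 ^ (10 * n) ∧ c' < 2 ^ (10 * n) ∧ F' < 2 ^ (10 * n) ∧
        s = st n k E τ t c' (mask ((pairs n (n * n * n)).foldl (growStep G) ({v}, {v}, c)).1) F' L
          (adjTable G) (powTable (n + 2)) D) := by
  obtain ⟨K, hK⟩ := halts_loop_of_loopFree (p := growCmd) (by simp [growCmd, Cmd.LoopFree])
    innerGuard
  refine ⟨K, fun n _ G k E τ c L D v hn hk hE hτ hc hL hD => ?_⟩
  have hpos := one_le_n (n := n)
  have hcube : n * n * n < 2 ^ (10 * n) := (cube_lt n).trans_le (two_pow_le_of_le (by omega))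
  let g : ℕ → Finset (Fin n) × Finset (Fin n) × ℕ := fun t =>
    (pairs n t).foldl (growStep G) ({v}, {v}, c)
  have hgc : ∀ t, (g t).2.2 < 2 ^ (10 * n) := fun t =>
    (foldl_growStep_snd_snd_le _ t).trans_lt hc
  refine (hK (n * n * n) (10 * n) (fun t s => s = st n k E τ t (g t).2.2 (mask (g t).1)
    (mask (g t).2.1) L (adjTable G) (powTable (n + 2)) D) (Nat.succ_le_of_lt (by positivity)) (by omega)
    ?_ ?_ ?_ _ rfl).mono le_rfl ?_
  · rintro t s rfl ht
    refine bounded_st _ _ _ _ _ _ _ _ _ _ _ _ ?_ adjTable_lt (powTable_lt le_rfl) hD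
    simp only [List.forall_mem_cons]
    exact ⟨hn, hk, hE, hτ, ht.trans_lt hcube, hgc t, mask_lt_ten _, mask_lt_ten _, hL, by simp⟩
  · rintro t s rfl ht
    exact val_innerGuard ..
  · rintro t s ht rfl
    have h := run_growCmd (G := G) (k := k) (E := E) (τ := τ) (t := t) (c := (g t).2.2) (D := D)
      (foldl_growStep_subset _ (subset_refl {v}) t : (g t).1 ⊆ (g t).2.1) L
    rw [h]
    have hg : g (t + 1) = growStep G (g t) (pairAt n t) := foldl_pairs_succ _ _ _
    rw [hg]
  · rintro s rfl
    exact ⟨_, _, _, hcube, hgc _, mask_lt_ten _, rfl⟩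

theorem halts_closeLoop : ∃ K : ℕ, ∀ (n : ℕ) [NeZero n] (G : SimpleGraph (Fin n))
    (k E τ c F : ℕ) (D : ℕ → ℕ) (A L : Finset (Fin n)), n < 2 ^ (10 * n) → k < 2 ^ (10 * n) →
    E < 2 ^ (10 * n) → τ < 2 ^ (10 * n) → c < 2 ^ (10 * n) → F < 2 ^ (10 * n) →
    (∀ z, D z < 2 ^ (10 * n)) →
    Halts (.loop innerGuard closeCmd)
      (st n k E τ 0 c (mask A) F (mask L) (adjTable G) (powTable (n + 2)) D)
      (K * (n * n * n) * (10 * n))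
      (· = st n k E τ (n * n * n) c (mask A) F
        (mask ((pairs n (n * n * n)).foldl (closeStep G Aᶜ) L))
          (adjTable G) (powTable (n + 2)) D) := by
  obtain ⟨K, hK⟩ := halts_loop_of_loopFree (p := closeCmd) (by simp [closeCmd, Cmd.LoopFree])
    innerGuard
  refine ⟨K, fun n _ G k E τ c F D A L hn hk hE hτ hc hF hD => ?_⟩
  have hpos := one_le_n (n := n)
  have hcube : n * n * n < 2 ^ (10 * n) := (cube_lt n).trans_le (two_pow_le_of_le (by omega))
  refine hK (n * n * n) (10 * n) (fun t s => s = st n k E τ t c (mask A) F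
    (mask ((pairs n t).foldl (closeStep G Aᶜ) L)) (adjTable G) (powTable (n + 2)) D)
    (Nat.succ_le_of_lt (by positivity)) (by omega) ?_ ?_ ?_ _ rfl
  · rintro t s rfl ht
    refine bounded_st _ _ _ _ _ _ _ _ _ _ _ _ ?_ adjTable_lt (powTable_lt le_rfl) hD
    simp only [List.forall_mem_cons]
    exact ⟨hn, hk, hE, hτ, ht.trans_lt hcube, hc, mask_lt_ten _, hF, mask_lt_ten _, by simp⟩
  · rintro t s rfl ht
    exact val_innerGuard ..
  · rintro t s ht rfl
    rw [run_closeCmd, foldl_pairs_succ]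

/-- The two inner loops of n³ iterations dominate; the loop-free pieces are absorbed by their
bounds. -/
theorem halts_tableCmd : ∃ K : ℕ, ∀ (n : ℕ) [NeZero n] (G : SimpleGraph (Fin n))
    (k E τ t c A F L : ℕ) (D : ℕ → ℕ), n < 2 ^ (10 * n) → k < 2 ^ (10 * n) →
    E < 2 ^ (10 * n) → τ < 2 ^ (10 * n) → t < 2 ^ (10 * n) → c < 2 ^ (10 * n) →
    A < 2 ^ (10 * n) → F < 2 ^ (10 * n) → L < 2 ^ (10 * n) → (∀ z, D z < 2 ^ (10 * n)) →
    Halts tableCmd (st n k E τ t c A F L (adjTable G) (powTable (n + 2)) D)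
      (K * (n * n * n) * (10 * n))
      (fun s => ∃ t' c' A' F' L', t' < 2 ^ (10 * n) ∧ c' < 2 ^ (10 * n) ∧ A' < 2 ^ (10 * n) ∧
        F' < 2 ^ (10 * n) ∧ L' < 2 ^ (10 * n) ∧
        s = st n k E (τ + 1) t' c' A' F' L' (adjTable G) (powTable (n + 2))
          (tableUpdate (sideAt G (bagAt G E τ) τ) (bagAt G E τ) D)) := by
  obtain ⟨K₁, h₁⟩ := Cmd.LoopFree.halts (p := growInit) (by simp [growInit, Cmd.LoopFree])
  obtain ⟨K₂, h₂⟩ := halts_growLoop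
  obtain ⟨K₃, h₃⟩ := Cmd.LoopFree.halts (p := closeInit) (by simp [closeInit, Cmd.LoopFree])
  obtain ⟨K₄, h₄⟩ := halts_closeLoop
  obtain ⟨K₅, h₅⟩ := Cmd.LoopFree.halts (p := updateCmd) (by simp [updateCmd, Cmd.LoopFree])
  refine ⟨K₁ + K₂ + K₃ + K₄ + K₅, fun n _ G k E τ t c A F L D hn hk hE hτ ht hc hA hF hL hD => ?_⟩
  have hpos := one_le_n (n := n)
  have hcube : n * n * n < 2 ^ (10 * n) := (cube_lt n).trans_le (two_pow_le_of_le (by omega))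
  have hb : ∀ {t c A F L : ℕ}, t < 2 ^ (10 * n) → c < 2 ^ (10 * n) → A < 2 ^ (10 * n) →
      F < 2 ^ (10 * n) → L < 2 ^ (10 * n) →
      (st n k E τ t c A F L (adjTable G) (powTable (n + 2)) D).Bounded (10 * n) := by
    intro t c A F L ht hc hA hF hL
    refine bounded_st _ _ _ _ _ _ _ _ _ _ _ _ ?_ adjTable_lt (powTable_lt le_rfl) hD
    simp only [List.forall_mem_cons]
    exact ⟨hn, hk, hE, hτ, ht, hc, hA, hF, hL, by simp⟩
  have h1N : 1 ≤ n * n * n := Nat.succ_le_of_lt (by positivity)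
  have hle : ∀ K : ℕ, K * (10 * n) ≤ K * (n * n * n) * (10 * n) := fun K =>
    Nat.mul_le_mul_right _ (Nat.le_mul_of_pos_right K h1N)
  refine Halts.mono (T := K₁ * (10 * n) + (K₂ * (n * n * n) * (10 * n) + (K₃ * (10 * n) +
    (K₄ * (n * n * n) * (10 * n) + K₅ * (10 * n))))) ?_ ?_ (fun s h => h)
  · refine (h₁ _ _ (by omega) (hb ht hc hA hF hL)).seq ?_
    rintro s rfl
    rw [run_growInit]
    refine (h₂ n G k E τ _ L D _ hn hk hE hτ
      (((Nat.mod_le _ _).trans (Nat.div_le_self _ _)).trans_lt hτ) hL hD).seq ?_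
    rintro s ⟨t, c, F, ht, hc, hF, rfl⟩
    refine (h₃ _ _ (by omega) (hb ht hc (mask_lt_ten _) hF hL)).seq ?_
    rintro s rfl
    rw [run_closeInit]
    refine (h₄ n G k E τ c F D _ _ hn hk hE hτ hc hF hD).seq ?_
    rintro s rfl
    refine (h₅ _ _ (by omega) (hb hcube hc (mask_lt_ten _) hF (mask_lt_ten _))).mono le_rfl ?_
    rintro s rfl
    rw [run_updateCmd]
    exact ⟨_, _, _, _, _, hcube, hc, mask_lt_ten _, hF, mask_lt_ten _, rfl⟩
  · have h1 := hle K₁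
    have h3 := hle K₃
    have h5 := hle K₅
    have : (K₁ + K₂ + K₃ + K₄ + K₅) * (n * n * n) * (10 * n) = K₁ * (n * n * n) * (10 * n) +
        K₂ * (n * n * n) * (10 * n) + K₃ * (n * n * n) * (10 * n) + K₄ * (n * n * n) * (10 * n) +
        K₅ * (n * n * n) * (10 * n) := by ring
    omega

theorem halts_outerLoop : ∃ K : ℕ, ∀ (n : ℕ) [NeZero n] (G : SimpleGraph (Fin n)) (k t : ℕ),
    k ≤ n → t < 2 ^ (10 * n) →
    Halts (.loop outerGuard tableCmd)
      (st n k (2 ^ (k + 2)) 0 t 0 0 0 0 (adjTable G) (powTable (n + 2)) (table G (2 ^ (k + 2)) 0))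
      (K * 2 ^ k * n ^ 7)
      (fun s => ∃ t' c' A' F' L', t' < 2 ^ (10 * n) ∧ c' < 2 ^ (10 * n) ∧ A' < 2 ^ (10 * n) ∧
        F' < 2 ^ (10 * n) ∧ L' < 2 ^ (10 * n) ∧
        s = st n k (2 ^ (k + 2)) (n * n * n * 2 ^ (k + 2)) t' c' A' F' L' (adjTable G)
          (powTable (n + 2)) (table G (2 ^ (k + 2)) (n * n * n * 2 ^ (k + 2)))) := by
  obtain ⟨K, hK⟩ := halts_tableCmd
  obtain ⟨C, hC⟩ := outerGuard.exists_bound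
  -- Here 40 is 4 · 10, from 2^(k+2) = 4 · 2^k and the length 10n; the exponent 7 is 3 for the outer
  -- loop, 3 for the inner loops and 1 for the length.
  refine ⟨40 * (K + 2 * C + 2), fun n _ G k t hk ht => ?_⟩
  have hpos := one_le_n (n := n)
  set E := 2 ^ (k + 2) with hE
  set N := n * n * n * E with hN
  have hn' : n < 2 ^ (10 * n) := Nat.lt_two_pow_self.trans_le (two_pow_le_of_le (by omega))
  have hE' : E < 2 ^ (10 * n) := Nat.pow_lt_pow_right (by norm_num) (by omega)
  -- The extra one is there because `table_le` allows entries up to `N + 1`. Lengths work out since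
  -- 3n + k + 2 ≤ 10n - 1.
  have hN' : N + 1 < 2 ^ (10 * n) := by
    have h1 : N ≤ 2 ^ (3 * n) * 2 ^ (k + 2) := Nat.mul_le_mul_right _ (cube_lt n).le
    rw [← pow_add] at h1
    have h2 : 2 ^ (3 * n + (k + 2)) ≤ 2 ^ (10 * n - 1) :=
      Nat.pow_le_pow_right (by norm_num) (by omega)
    have h3 : 2 ^ (10 * n) = 2 * 2 ^ (10 * n - 1) := by
      rw [← pow_succ', Nat.sub_add_cancel (by omega)]
    have h4 : 2 ^ 1 ≤ 2 ^ (10 * n - 1) := Nat.pow_le_pow_right (by norm_num) (by omega)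
    omega
  have hD : ∀ τ ≤ N, ∀ z, table G E τ z < 2 ^ (10 * n) := fun τ hτ z => by
    have := table_le (G := G) E τ z
    omega
  have h0 : 0 < 2 ^ (10 * n) := Nat.two_pow_pos _
  refine (halts_loop (T := K * (n * n * n) * (10 * n)) (C := C * (10 * n)) (N := N)
    (fun τ s => ∃ t' c' A' F' L', t' < 2 ^ (10 * n) ∧ c' < 2 ^ (10 * n) ∧ A' < 2 ^ (10 * n) ∧
        F' < 2 ^ (10 * n) ∧ L' < 2 ^ (10 * n) ∧
        s = st n k E τ t' c' A' F' L' (adjTable G) (powTable (n + 2)) (table G E τ)) ?_ ?_ ?_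
    ⟨t, 0, 0, 0, 0, ht, h0, h0, h0, h0, rfl⟩).mono ?_ (fun s h => h)
  · rintro τ s ⟨t, c, A, F, L, -, -, -, -, -, rfl⟩ -
    simp only [outerGuard, cubeExp, AExp.val, Op.apply, st_reg]
    omega
  · rintro τ s ⟨t, c, A, F, L, ht, hc, hA, hF, hL, rfl⟩ hτ
    refine (hC _ (10 * n) (by omega) (bounded_st _ _ _ _ _ _ _ _ _ _ _ _ ?_ adjTable_lt
      (powTable_lt le_rfl) (hD τ hτ))).2
    simp only [List.forall_mem_cons]
    exact ⟨hn', by omega, hE', by omega, ht, hc, hA, hF, hL, by simp⟩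
  · rintro τ s hτ ⟨t, c, A, F, L, ht, hc, hA, hF, hL, rfl⟩
    exact hK n G k E τ t c A F L _ hn' (by omega) hE' (by omega) ht hc hA hF hL (hD τ hτ.le)
  · have h1 : 1 ≤ n * n * n := Nat.succ_le_of_lt (by positivity)
    have h2 : 1 ≤ N := Nat.succ_le_of_lt (by positivity)
    have h3 : 1 ≤ n * n * n * (10 * n) := Nat.succ_le_of_lt (by positivity)
    have h4 : 1 * (10 * n) ≤ n * n * n * (10 * n) := Nat.mul_le_mul_right _ h1
    have h5 : 40 * (K + 2 * C + 2) * 2 ^ k * n ^ 7 =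
        N * ((K + 2 * C + 2) * (n * n * n * (10 * n))) := by
      rw [hN, hE]
      ring
    rw [h5]
    set X := n * n * n * (10 * n) with hX
    have h6 : K * (n * n * n) * (10 * n) = K * X := by rw [hX]; ring
    have h7 : C * (10 * n) ≤ C * X := Nat.mul_le_mul_left C (by omega)
    have h8 : 1 * (C * X + 1) ≤ N * (C * X + 1) := Nat.mul_le_mul_right _ h2
    calc N * (K * (n * n * n) * (10 * n) + C * (10 * n) + 1) + C * (10 * n) + 1
        ≤ N * (K * X + C * X + 1) + (C * X + 1) := by
          rw [h6]
          have : N * (K * X + C * (10 * n) + 1) ≤ N * (K * X + C * X + 1) :=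
            Nat.mul_le_mul_left N (by omega)
          omega
      _ ≤ N * (K * X + C * X + 1) + N * (C * X + 1) := by omega
      _ = N * (K * X + 2 * C * X + 2) := by ring
      _ ≤ N * ((K + 2 * C + 2) * X) := Nat.mul_le_mul_left N (by nlinarith)

theorem halts_powLoop : ∃ K : ℕ, ∀ (n : ℕ) [NeZero n] (G : SimpleGraph (Fin n)) (k E : ℕ),
    k ≤ n → Halts (.loop powGuard powCmd)
      (st n k 0 0 0 0 0 0 0 (adjTable G) (powTable 0) (table G E 0))
      (K * n ^ 2)
      (· = st n k 0 0 (n + 2) 0 0 0 0 (adjTable G) (powTable (n + 2)) (table G E 0)) := by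
  obtain ⟨K, hK⟩ := halts_loop_of_loopFree (p := powCmd) (by simp [powCmd, Cmd.LoopFree]) powGuard
  refine ⟨30 * K, fun n _ G k E hk => ?_⟩
  have hpos := one_le_n (n := n)
  have h1 : n < 2 ^ n := Nat.lt_two_pow_self
  have h2 : n + 2 < 2 ^ (10 * n) := by
    have h3 : n + 2 < 2 ^ (n + 2) := Nat.lt_two_pow_self
    exact h3.trans_le (two_pow_le_of_le (by omega))
  have h0 : 0 < 2 ^ (10 * n) := Nat.two_pow_pos _
  refine (hK (n + 2) (10 * n) (fun t s => s = st n k 0 0 t 0 0 0 0 (adjTable G) (powTable t)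
    (table G E 0)) (by omega) (by omega) ?_ ?_ ?_ _ rfl).mono ?_ (fun s h => h)
  · rintro t s rfl ht
    refine bounded_st _ _ _ _ _ _ _ _ _ _ _ _ ?_ adjTable_lt (powTable_lt ht) ?_
    · simp only [List.forall_mem_cons]
      exact ⟨by omega, by omega, h0, h0, by omega, h0, h0, h0, h0, by simp⟩
    · intro z
      have := table_le (G := G) E 0 z
      omega
  · rintro t s rfl ht
    simp only [powGuard, AExp.val, Op.apply, st_reg]
    omega
  · rintro t s ht rfl
    exact run_powCmd
  · calc K * (n + 2) * (10 * n) ≤ K * (3 * n) * (10 * n) :=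
          Nat.mul_le_mul_right _ (Nat.mul_le_mul_left K (by omega))
      _ = 30 * K * n ^ 2 := by ring

theorem halts_pathContraction : ∃ K : ℕ, ∀ (n : ℕ) [NeZero n] (G : SimpleGraph (Fin n)) (k : ℕ),
    Halts pathContraction (inputStore G k) (K * 2 ^ k * n ^ 7)
      (fun s => s.reg 0 = if table G (2 ^ (min k n + 2)) (n * n * n * 2 ^ (min k n + 2))
        (2 ^ n - 1) + min k n - n ≠ 0 then 1 else 0) := by
  obtain ⟨K₁, h₁⟩ := Cmd.LoopFree.halts (p := initCmd) (by simp [initCmd, Cmd.LoopFree])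
  obtain ⟨K₂, h₂⟩ := halts_powLoop
  obtain ⟨K₃, h₃⟩ := Cmd.LoopFree.halts (p := rangeCmd) (by simp [rangeCmd, Cmd.LoopFree])
  obtain ⟨K₄, h₄⟩ := halts_outerLoop
  obtain ⟨K₅, h₅⟩ := Cmd.LoopFree.halts (p := answerCmd) (by simp [answerCmd, Cmd.LoopFree])
  refine ⟨3 * K₁ + K₂ + 10 * K₃ + K₄ + 10 * K₅, fun n _ G k => ?_⟩
  have hpos := one_le_n (n := n)
  have hn2 : n + 2 < 2 ^ (10 * n) := by
    have h3 : n + 2 < 2 ^ (n + 2) := Nat.lt_two_pow_self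
    exact h3.trans_le (two_pow_le_of_le (by omega))
  have h0 : 0 < 2 ^ (10 * n) := Nat.two_pow_pos _
  have hm : min k n ≤ n := min_le_right _ _
  set m := min k n
  have hE' : 2 ^ (m + 2) < 2 ^ (10 * n) := Nat.pow_lt_pow_right (by norm_num) (by omega)
  have hN' : n * n * n * 2 ^ (m + 2) + 1 < 2 ^ (10 * n) := by
    have h1 : n * n * n * 2 ^ (m + 2) ≤ 2 ^ (3 * n) * 2 ^ (m + 2) :=
      Nat.mul_le_mul_right _ (cube_lt n).le
    rw [← pow_add] at h1
    have h2 : 2 ^ (3 * n + (m + 2)) ≤ 2 ^ (10 * n - 1) :=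
      Nat.pow_le_pow_right (by norm_num) (by omega)
    have h3 : 2 ^ (10 * n) = 2 * 2 ^ (10 * n - 1) := by
      rw [← pow_succ', Nat.sub_add_cancel (by omega)]
    have h4 : 2 ^ 1 ≤ 2 ^ (10 * n - 1) := Nat.pow_le_pow_right (by norm_num) (by omega)
    omega
  refine Halts.mono (T := K₁ * (n + k + 1) + (K₂ * n ^ 2 + (K₃ * (10 * n) +
    (K₄ * 2 ^ m * n ^ 7 + K₅ * (10 * n))))) ?_ ?_ (fun s h => h)
  -- Before `initCmd` the register of `k` is not bounded in terms of `n`, so this stage alone is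
  -- charged with the length n + k + 1.
  · refine (h₁ _ _ (by omega) ?_).seq ?_
    · have hsize : ∀ x : ℕ, x.size ≤ x + 1 := fun x =>
        Nat.size_le.2 (Nat.lt_two_pow_self.trans_le (Nat.pow_le_pow_right (by norm_num) (by omega)))
      refine ⟨fun x => ?_, fun a i => ?_⟩
      · refine (hsize _).trans ?_
        simp only [inputStore]
        split_ifs <;> omega
      · have : (inputStore G k).arr a i < 2 ^ 1 := by
          simp only [inputStore]
          split_ifs <;> norm_num
        exact (Nat.size_le.2 this).trans (by omega)
    rintro s rfl
    rw [run_initCmd (E := 2 ^ (m + 2))]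
    refine (h₂ n G m (2 ^ (m + 2)) hm).seq ?_
    rintro s rfl
    refine (h₃ _ (10 * n) (by omega) (bounded_st _ _ _ _ _ _ _ _ _ _ _ _ ?_ adjTable_lt
      (powTable_lt le_rfl) ?_)).seq ?_
    · simp only [List.forall_mem_cons]
      exact ⟨by omega, by omega, h0, h0, by omega, h0, h0, h0, h0, by simp⟩
    · intro z
      have := table_le (G := G) (2 ^ (m + 2)) 0 z
      omega
    rintro s rfl
    have hrun : rangeCmd.run (st n m 0 0 (n + 2) 0 0 0 0 (adjTable G) (powTable (n + 2))
        (table G (2 ^ (m + 2)) 0)) = st n m (2 ^ (m + 2)) 0 (n + 2) 0 0 0 0 (adjTable G)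
          (powTable (n + 2)) (table G (2 ^ (m + 2)) 0) := by
      simp only [rangeCmd, Cmd.run, AExp.val, Op.apply, st_reg, st_arr, st_setReg]
      rw [powTable_apply (by omega)]
    rw [hrun]
    refine (h₄ n G m (n + 2) hm hn2).seq ?_
    rintro s ⟨t, c, A, F, L, ht, hc, hA, hF, hL, rfl⟩
    refine (h₅ _ (10 * n) (by omega) (bounded_st _ _ _ _ _ _ _ _ _ _ _ _ ?_ adjTable_lt
      (powTable_lt le_rfl) ?_)).mono le_rfl ?_
    · simp only [List.forall_mem_cons]
      exact ⟨by omega, by omega, hE', by omega, ht, hc, hA, hF, hL, by simp⟩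
    · intro z
      have := table_le (G := G) (2 ^ (m + 2)) (n * n * n * 2 ^ (m + 2)) z
      omega
    rintro s rfl
    simp only [answerCmd, Cmd.run, AExp.val, Op.apply, st_reg, st_arr]
    rw [powTable_apply (show n ≤ n + 2 by omega)]
    split_ifs <;> simp only [st_setReg, st_reg]
  -- This absorbs the charge for reading the original `k` into the factor 2^k.
  · have hk : k < 2 ^ k := Nat.lt_two_pow_self
    have hk1 : 1 ≤ 2 ^ k := Nat.one_le_two_pow
    have hpow : ∀ i ≤ 7, n ^ i ≤ n ^ 7 := fun i hi => Nat.pow_le_pow_right hpos hi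
    have hZ : ∀ i ≤ 7, n ^ i ≤ 2 ^ k * n ^ 7 := fun i hi =>
      (hpow i hi).trans (Nat.le_mul_of_pos_left _ hk1)
    have hn1 : n ≤ 2 ^ k * n ^ 7 := by simpa using hZ 1 (by norm_num)
    have hkk : 2 ^ k ≤ 2 ^ k * n ^ 7 := Nat.le_mul_of_pos_right _ (by positivity)
    have e1 : K₁ * (n + k + 1) ≤ K₁ * (3 * (2 ^ k * n ^ 7)) := Nat.mul_le_mul_left _ (by omega)
    have e2 : K₂ * n ^ 2 ≤ K₂ * (2 ^ k * n ^ 7) := Nat.mul_le_mul_left _ (hZ 2 (by norm_num))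
    have e3 : K₃ * (10 * n) ≤ K₃ * (10 * (2 ^ k * n ^ 7)) := Nat.mul_le_mul_left _ (by omega)
    have e5 : K₅ * (10 * n) ≤ K₅ * (10 * (2 ^ k * n ^ 7)) := Nat.mul_le_mul_left _ (by omega)
    have e4 : K₄ * 2 ^ m * n ^ 7 ≤ K₄ * 2 ^ k * n ^ 7 :=
      Nat.mul_le_mul_right _ (Nat.mul_le_mul_left _
        (Nat.pow_le_pow_right (by norm_num) (min_le_left _ _)))
    calc _ ≤ K₁ * (3 * (2 ^ k * n ^ 7)) + (K₂ * (2 ^ k * n ^ 7) + (K₃ * (10 * (2 ^ k * n ^ 7)) +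
          (K₄ * 2 ^ k * n ^ 7 + K₅ * (10 * (2 ^ k * n ^ 7))))) := by omega
      _ = _ := by ring

end PathContr

theorem corollary1 :
    ∃ (p : PathContr.Cmd) (c : ℕ), ∀ (n k : ℕ) (G : SimpleGraph (Fin n)), G.Connected →
      ∃ (s : PathContr.Store) (t : ℕ),
        PathContr.Exec p (PathContr.inputStore G k) s t ∧
        t ≤ c * 2 ^ k * n ^ c ∧
        (PathContr.ContractibleToPath k G → s.reg 0 = 1) ∧
        (¬ PathContr.ContractibleToPath k G → s.reg 0 = 0) := by
  obtain ⟨K, hK⟩ := PathContr.halts_pathContraction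
  -- One constant has to serve as coefficient and as exponent; raising the exponent above 7 is
  -- allowed since n ≥ 1.
  refine ⟨PathContr.pathContraction, K + 7, fun n k G hG => ?_⟩
  have hn : 0 < n := Fin.pos_iff_nonempty.2 hG.nonempty
  have : NeZero n := ⟨hn.ne'⟩
  obtain ⟨s, t, h1, h2, h3⟩ := hK n G k
  have h4 := PathContr.table_univ hG k
  refine ⟨s, t, h1, h2.trans ?_, fun h => ?_, fun h => ?_⟩
  · exact Nat.mul_le_mul (Nat.mul_le_mul_right _ (by omega)) (Nat.pow_le_pow_right hn (by omega))
  · rw [h3, if_pos (h4.2 h)]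
  · rw [h3, if_neg (mt h4.1 h)]
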